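/- An affine formula $\phi$ is a conjunction of linear equations over $\mathbb{F}_2$ in a finite set of Boolean variables. \textsc{Max Differ Affine-SAT} asks, given an affine formula $\phi$ and a non-negative integer $d$, whether $\phi$ has two satisfying assignments that differ on at least $d$ variables. Theorem. \textsc{Max Differ Affine-SAT}, parameterized by $d$, admits a polynomial kernel with $\mathcal{O}(d^2)$ variables and $\mathcal{O}(d^2)$ equations. That is, there are a polynomial-time algorithm, a constant $C$ and a polynomial $p$ such that the algorithm maps every instance $(\phi,d)$ to an instance $(\phi',d')$ of \textsc{Max Differ Affine-SAT} with the following properties: $(\phi',d')$ is a YES instance if and only if $(\phi,d)$ is; $\phi'$ has at most $C\,d^2$ variables and at most $C\,d^2$ equations; and the total size of $(\phi',d')$, including $d'$, is at most $p(d)$. (As usual for parameterized problems, the size of an instance $(\phi,d)$ is the size of $\phi$, in which all its variables are counted, plus $d$.) -/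

import Mathlib

/-- A linear equation `∑ i, coeff i * x i = rhs` over the two-element field, in the variables
`x 0, …, x (n - 1)`. The variables that appear in it are those with coefficient `1`. -/
structure AffineEquation (n : ℕ) where
  coeff : Fin n → ZMod 2
  rhs : ZMod 2

/-- An affine formula: a variable set `Fin numVars` together with a conjunction (a finite list)
of linear equations over the two-element field in these variables. -/
structure AffineFormula where
  numVars : ℕ
  equations : List (AffineEquation numVars)

/-- An assignment satisfies an equation. -/
def AffineEquation.Holds {n : ℕ} (e : AffineEquation n) (σ : Fin n → ZMod 2) : Prop :=
  ∑ i, e.coeff i * σ i = e.rhs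

/-- An assignment of all variables satisfies an affine formula. -/
def AffineFormula.Satisfies (φ : AffineFormula) (σ : Fin φ.numVars → ZMod 2) : Prop :=
  ∀ e ∈ φ.equations, e.Holds σ

/-- An instance `(φ, d)` of Max Differ Affine-SAT; `d` is the parameter. -/
structure MaxDifferAffineSAT where
  formula : AffineFormula
  d : ℕ

namespace MaxDifferAffineSAT

/-- YES instances: there are two satisfying assignments that differ on at least `d` variables
(`hammingDist` counts the variables on which they differ). -/
def IsYes (I : MaxDifferAffineSAT) : Prop :=
  ∃ σ₁ σ₂ : Fin I.formula.numVars → ZMod 2,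
    I.formula.Satisfies σ₁ ∧ I.formula.Satisfies σ₂ ∧ I.d ≤ hammingDist σ₁ σ₂

/-- The finite alphabet in which instances are written down. -/
inductive Symbol : Type
  | param
  | var
  | eqn
  | bit (b : ZMod 2)
  deriving DecidableEq, Fintype

/-- One equation: a marker, the `n` coefficients, the right-hand side. -/
def encodeEquation {n : ℕ} (e : AffineEquation n) : List Symbol :=
  Symbol.eqn :: ((List.ofFn e.coeff).map Symbol.bit ++ [Symbol.bit e.rhs])

/-- An instance as a word: the parameter in unary, the variables in unary, and the augmented
matrix of the system row by row. So its length is polynomially related to the size of the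
formula plus the parameter, the usual size of an instance of a parameterized problem. -/
def encode (I : MaxDifferAffineSAT) : List Symbol :=
  List.replicate I.d Symbol.param ++
    (List.replicate I.formula.numVars Symbol.var ++
      I.formula.equations.flatMap encodeEquation)

/-- The length of the encoding of an instance. -/
theorem length_encode (I : MaxDifferAffineSAT) :
    I.encode.length = I.d + (I.formula.numVars +
      I.formula.equations.length * (I.formula.numVars + 2)) := by
  simp [encode, encodeEquation, List.length_flatMap]

theorem encodeEquation_append_inj {n : ℕ} {e e' : AffineEquation n} {l l' : List Symbol}
    (h : encodeEquation e ++ l = encodeEquation e' ++ l') : e = e' ∧ l = l' := by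
  obtain ⟨h1, h2⟩ := List.append_inj h (by simp [encodeEquation])
  refine ⟨?_, h2⟩
  simp only [encodeEquation, List.cons.injEq, true_and] at h1
  obtain ⟨h3, h4⟩ := List.append_inj h1 (by simp)
  have h5 := List.ofFn_injective
    (List.map_injective_iff.mpr (fun a b hab => Symbol.bit.inj hab) h3)
  cases e; cases e'
  simp_all

theorem flatMap_encodeEquation_injective {n : ℕ} (l l' : List (AffineEquation n))
    (h : l.flatMap encodeEquation = l'.flatMap encodeEquation) : l = l' := by
  induction l generalizing l' with
  | nil => cases l' with
    | nil => rfl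
    | cons e l' => simp [encodeEquation] at h
  | cons e l ih => cases l' with
    | nil => simp [encodeEquation] at h
    | cons e' l' =>
      rw [List.flatMap_cons, List.flatMap_cons] at h
      obtain ⟨h1, h2⟩ := encodeEquation_append_inj h
      rw [h1, ih l' h2]

/-- Different instances have different encodings. -/
theorem encode_injective : Function.Injective encode := by
  rintro ⟨⟨n, l⟩, d⟩ ⟨⟨n', l'⟩, d'⟩ h
  have cnt : ∀ (k : ℕ) (L : List (AffineEquation k)),
      (L.flatMap encodeEquation).count Symbol.param = 0 ∧
      (L.flatMap encodeEquation).count Symbol.var = 0 := by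
    intro k L
    constructor <;> rw [List.count_eq_zero] <;>
      simp [encodeEquation]
  have hd : d = d' := by
    have := congrArg (List.count Symbol.param) h
    simpa [encode, (cnt _ _).1, List.count_replicate] using this
  subst hd
  have hn : n = n' := by
    have := congrArg (List.count Symbol.var) h
    simpa [encode, (cnt _ _).2, List.count_replicate] using this
  subst hn
  have hl : l = l' := by
    apply flatMap_encodeEquation_injective
    simpa [encode] using h
  rw [hl]

/-- `f` is a polynomial kernelization for Max Differ Affine-SAT parameterized by `d`: it is
computed in polynomial time by a (multi-stack) Turing machine, it maps every instance to an
equivalent instance, and the size of the output (including the new parameter) is bounded by a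
polynomial in the parameter of the input alone. -/
structure IsPolynomialKernelization (f : MaxDifferAffineSAT → MaxDifferAffineSAT) : Prop where
  polyTime : Nonempty (Turing.TM2ComputableInPolyTime encode encode f)
  equiv : ∀ I, (f I).IsYes ↔ I.IsYes
  size_le : ∃ p : Polynomial ℕ, ∀ I, (f I).encode.length ≤ p.eval I.d

end MaxDifferAffineSAT

/-! If the formula is satisfiable, the differences of its satisfying assignments form exactly the
solution space V of the homogeneous system, so a YES instance is one where V contains a vector of
weight at least d (`isYes_iff`). Call a coordinate live if some vector of V is nonzero there. A
uniformly random vector of V is nonzero at each live coordinate with probability 1/2, so some vector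
has weight at least half the number of live coordinates (`exists_le_hammingNorm`). Hence 2d live
coordinates force YES. Otherwise the dead coordinates can be dropped without changing any weight,
which leaves a subspace of dimension-m space with m < 2d. It equals its double orthogonal complement
(`mem_of_dotProduct`), so it is the solution space of the equations given by m vectors spanning its
complement. The bounds obtained are therefore linear: at most 2d variables and 2d equations.
Unsatisfiable formulas and formulas with many live coordinates are mapped to constant instances.

All the linear algebra is one operation (`elim_spec`): from a list spanning U, make a list of the
same length spanning the part of U orthogonal to a. The first vector with product 1 becomes the
pivot and is replaced by zero; the pivot is added to each later vector with product 1. Starting from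
the standard basis, this solves any homogeneous system. It is applied to the rows of the formula to
get V, and to the restricted vectors spanning V to get the orthogonal complement. Right-hand sides
are treated as an additional coordinate: the formula is satisfiable iff that coordinate is not
identically zero on the solution space, and requiring it to vanish leaves V.

For the running time, the algorithm is written in a small structured language with a step-counting
semantics `StackProg.Runs`, compiled once and for all to a `TM2` machine (`StackProg.Runs.sound`).
Elimination, detection of live coordinates and restriction are the same sweep over a list of vectors
(`runs_sweep`) with different local rules, and the total time is cubic (`exists_runs_main`). -/

/-! ### A structured programming language for stacks -/

/-- A basic operation on stacks `K` over the alphabet `Γ`, with registers `R`. -/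
inductive StackOp (K Γ R : Type)
  | push (k : K) (c : R → Bool) (f : R → Γ)
  | pop (k : K) (f : R → Option Γ → R)
  | peek (k : K) (f : R → Option Γ → R)
  | load (f : R → R)

/-- Structured programs. `loop pre c p` executes `pre`, stops if the condition `c` fails, and
otherwise executes `p` and starts again. -/
inductive StackProg (K Γ R : Type)
  | block (ops : List (StackOp K Γ R))
  | seq (p q : StackProg K Γ R)
  | ite (c : R → Bool) (p q : StackProg K Γ R)
  | loop (pre : List (StackOp K Γ R)) (c : R → Bool) (p : StackProg K Γ R)

section StackProg

variable {K Γ R : Type} [DecidableEq K]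

/-- The effect of an operation on registers and stacks. -/
def StackOp.exec : StackOp K Γ R → R × (K → List Γ) → R × (K → List Γ)
  | push k c f, s => (s.1, if c s.1 then Function.update s.2 k (f s.1 :: s.2 k) else s.2)
  | pop k f, s => (f s.1 (s.2 k).head?, Function.update s.2 k (s.2 k).tail)
  | peek k f, s => (f s.1 (s.2 k).head?, s.2)
  | load f, s => (f s.1, s.2)

/-- The effect of a block of operations. -/
def StackOp.execs : List (StackOp K Γ R) → R × (K → List Γ) → R × (K → List Γ)
  | [], s => s
  | o :: l, s => execs l (o.exec s)

/-- `Runs p s s' t`: the program `p` leads from `s` to `s'` in at most `t` steps. -/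
inductive StackProg.Runs : StackProg K Γ R → R × (K → List Γ) → R × (K → List Γ) → ℕ → Prop
  | block (ops s) : Runs (.block ops) s (StackOp.execs ops s) 1
  | seq {p q s s' s'' t t'} : Runs p s s' t → Runs q s' s'' t' → Runs (.seq p q) s s'' (t + t')
  | ite_true {c p q s s' t} : c s.1 = true → Runs p s s' t → Runs (.ite c p q) s s' (t + 1)
  | ite_false {c p q s s' t} : c s.1 = false → Runs q s s' t → Runs (.ite c p q) s s' (t + 1)
  | loop_step {pre c p s s' s'' t t'} : c (StackOp.execs pre s).1 = true →
      Runs p (StackOp.execs pre s) s' t → Runs (.loop pre c p) s' s'' t' →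
      Runs (.loop pre c p) s s'' (t' + (t + 1))
  | loop_exit {pre c p s} : c (StackOp.execs pre s).1 = false →
      Runs (.loop pre c p) s (StackOp.execs pre s) 1
  | mono {p s s' t t'} : Runs p s s' t → t ≤ t' → Runs p s s' t'

/-! ### Compilation to Turing machines -/

/-- The control points of a program. -/
def StackProg.Pos : StackProg K Γ R → Type
  | block _ => Unit
  | seq p q => p.Pos ⊕ q.Pos
  | ite _ p q => Option (p.Pos ⊕ q.Pos)
  | loop _ _ p => Option p.Pos

/-- There are finitely many control points. -/
@[reducible]
noncomputable def StackProg.posFintype : (p : StackProg K Γ R) → Fintype p.Pos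
  | block _ => inferInstanceAs (Fintype Unit)
  | seq p q => letI := p.posFintype; letI := q.posFintype
    inferInstanceAs (Fintype (p.Pos ⊕ q.Pos))
  | ite _ p q => letI := p.posFintype; letI := q.posFintype
    inferInstanceAs (Fintype (Option (p.Pos ⊕ q.Pos)))
  | loop _ _ p => letI := p.posFintype
    inferInstanceAs (Fintype (Option p.Pos))

/-- The control point at which a program starts. -/
def StackProg.entry : (p : StackProg K Γ R) → p.Pos
  | block _ => ()
  | seq p _ => Sum.inl p.entry
  | ite _ _ _ => none
  | loop _ _ _ => none

open Turing in
/-- A block of operations, followed by a statement. -/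
def StackOp.stmt {L : Type} : List (StackOp K Γ R) → TM2.Stmt (fun _ : K => Γ) L R →
    TM2.Stmt (fun _ : K => Γ) L R
  | [], q => q
  | push k c f :: l, q => .branch c (.push k f (stmt l q)) (stmt l q)
  | pop k f :: l, q => .pop k f (stmt l q)
  | peek k f :: l, q => .peek k f (stmt l q)
  | load f :: l, q => .load f (stmt l q)

open Turing in
/-- The machine statements of a program whose control points are embedded in a set of labels. -/
def StackProg.code {L : Type} : (p : StackProg K Γ R) → (p.Pos → L) → L → p.Pos →
    TM2.Stmt (fun _ : K => Γ) L R
  | block ops, _, e, _ => StackOp.stmt ops (.goto fun _ => e)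
  | seq p q, i, e, x => match x with
    | Sum.inl x => p.code (fun y => i (Sum.inl y)) (i (Sum.inr q.entry)) x
    | Sum.inr x => q.code (fun y => i (Sum.inr y)) e x
  | ite c p q, i, e, x => match x with
    | none => .branch c (.goto fun _ => i (some (Sum.inl p.entry)))
        (.goto fun _ => i (some (Sum.inr q.entry)))
    | some (Sum.inl x) => p.code (fun y => i (some (Sum.inl y))) e x
    | some (Sum.inr x) => q.code (fun y => i (some (Sum.inr y))) e x
  | loop pre c p, i, e, x => match x with
    | none => StackOp.stmt pre (.branch c (.goto fun _ => i (some p.entry)) (.goto fun _ => e))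
    | some x => p.code (fun y => i (some y)) (i none) x

open Turing in
theorem StackOp.stepAux_stmt {L : Type} (ops : List (StackOp K Γ R))
    (q : TM2.Stmt (fun _ : K => Γ) L R) (s : R × (K → List Γ)) :
    TM2.stepAux (stmt ops q) s.1 s.2 = TM2.stepAux q (execs ops s).1 (execs ops s).2 := by
  induction ops generalizing s with
  | nil => rfl
  | cons o l ih =>
    cases o with
    | push k c f =>
      rw [execs, ← ih]
      cases h : c s.1 <;> simp [stmt, exec, h]
    | pop k f => rw [execs, ← ih]; simp [stmt, exec]
    | peek k f => rw [execs, ← ih]; simp [stmt, exec]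
    | load f => rw [execs, ← ih]; simp [stmt, exec]

open Turing in
/-- The machine configuration at a label. -/
def StackProg.cfg {L : Type} (l : L) (s : R × (K → List Γ)) : TM2.Cfg (fun _ : K => Γ) L R :=
  ⟨some l, s.1, s.2⟩

open Turing in
/-- A compiled program does what the program does. -/
theorem StackProg.Runs.sound {p : StackProg K Γ R} {s s' : R × (K → List Γ)} {t : ℕ}
    (h : p.Runs s s' t) {L : Type} (M : L → TM2.Stmt (fun _ : K => Γ) L R) (i : p.Pos → L) (e : L)
    (hM : ∀ x, M (i x) = p.code i e x) :
    ∃ t' ≤ t, (flip bind (TM2.step M))^[t'] (some (cfg (i p.entry) s)) = some (cfg e s') := by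
  have one : ∀ (l : L) (s : R × (K → List Γ)) c, TM2.stepAux (M l) s.1 s.2 = c →
      (flip bind (TM2.step M))^[1] (some (cfg l s)) = some c := by
    rintro l s c rfl
    rfl
  induction h generalizing L with
  | block ops s => exact ⟨1, le_rfl, one _ _ _ ((congrArg (fun q => TM2.stepAux q s.1 s.2)
      (hM ())).trans (by simp only [code, StackOp.stepAux_stmt]; rfl))⟩
  | @seq p q s s' s'' t t' _ _ ih ih' =>
    obtain ⟨a, ha, ha'⟩ := ih M (fun y => i (Sum.inl y)) (i (Sum.inr q.entry))
      (fun x => hM (Sum.inl x)) one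
    obtain ⟨b, hb, hb'⟩ := ih' M (fun y => i (Sum.inr y)) e (fun x => hM (Sum.inr x)) one
    refine ⟨b + a, by omega, ?_⟩
    rw [Function.iterate_add_apply, show (StackProg.seq p q).entry = Sum.inl p.entry from rfl,
      ha', hb']
  | @ite_true c p q s s' t hc _ ih =>
    obtain ⟨a, ha, ha'⟩ := ih M (fun y => i (some (Sum.inl y))) e
      (fun x => hM (some (Sum.inl x))) one
    refine ⟨a + 1, by omega, ?_⟩
    rw [Function.iterate_add_apply,
      one (i (StackProg.ite c p q).entry) _ (cfg (i (some (Sum.inl p.entry))) s)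
      ((congrArg (fun q => TM2.stepAux q s.1 s.2) (hM none)).trans (by simp [code, hc, cfg])), ha']
  | @ite_false c p q s s' t hc _ ih =>
    obtain ⟨a, ha, ha'⟩ := ih M (fun y => i (some (Sum.inr y))) e
      (fun x => hM (some (Sum.inr x))) one
    refine ⟨a + 1, by omega, ?_⟩
    rw [Function.iterate_add_apply,
      one (i (StackProg.ite c p q).entry) _ (cfg (i (some (Sum.inr q.entry))) s)
      ((congrArg (fun q => TM2.stepAux q s.1 s.2) (hM none)).trans (by simp [code, hc, cfg])), ha']
  | @loop_step pre c p s s' s'' t t' hc _ _ ih ih' =>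
    -- The exit label of the body is the head of the loop, so the remaining rounds run the same code
    -- under the same embedding.
    obtain ⟨a, ha, ha'⟩ := ih M (fun y => i (some y)) (i none) (fun x => hM (some x)) one
    obtain ⟨b, hb, hb'⟩ := ih' M i e hM one
    refine ⟨b + (a + 1), by omega, ?_⟩
    rw [Function.iterate_add_apply, Function.iterate_add_apply,
      one (i (StackProg.loop pre c p).entry) _ (cfg (i (some p.entry)) (StackOp.execs pre s))
      ((congrArg (fun q => TM2.stepAux q s.1 s.2) (hM none)).trans
        (by simp [code, hc, cfg, StackOp.stepAux_stmt])), ha']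
    exact hb'
  | @loop_exit pre c p s hc =>
    exact ⟨1, le_rfl, one _ _ _ ((congrArg (fun q => TM2.stepAux q s.1 s.2) (hM none)).trans
      (by simp [code, hc, cfg, StackOp.stepAux_stmt]))⟩
  | mono _ hle ih =>
    obtain ⟨a, ha, ha'⟩ := ih M i e hM one
    exact ⟨a, ha.trans hle, ha'⟩

open Turing in
/-- The Turing machine of a program. -/
noncomputable def StackProg.machine [Fintype K] [Fintype Γ] [Fintype R] (p : StackProg K Γ R)
    (k₀ k₁ : K) (r : R) : FinTM2 :=
  letI := p.posFintype
  { K := K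
    k₀ := k₀
    k₁ := k₁
    Γ := fun _ => Γ
    Λ := Option p.Pos
    main := some p.entry
    ΛFin := inferInstanceAs (Fintype (Option p.Pos))
    σ := R
    initialState := r
    m := fun l => match l with
      | none => .halt
      | some x => p.code some none x }

open Turing in
/-- A function is computable in polynomial time if a program computes it in polynomial time. -/
theorem StackProg.computableInPolyTime [Fintype K] [Fintype Γ] [Fintype R] {α β : Type}
    {ea : α → List Γ} {eb : β → List Γ} {f : α → β} (p : StackProg K Γ R) (k₀ k₁ : K) (r : R)
    (T : Polynomial ℕ)
    (h : ∀ a, p.Runs (r, Function.update (fun _ => []) k₀ (ea a))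
      (r, Function.update (fun _ => []) k₁ (eb (f a))) (T.eval (ea a).length)) :
    Nonempty (TM2ComputableInPolyTime ea eb f) := by
  refine ⟨{ tm := p.machine k₀ k₁ r
            inputAlphabet := Equiv.refl Γ
            outputAlphabet := Equiv.refl Γ
            -- The additional step executes the halt statement at the exit label `none`.
            time := T + 1
            outputsFun := fun a => ?_ }⟩
  have hs := (h a).sound (p.machine k₀ k₁ r).m some none (fun x => rfl)
  have hin : initList (p.machine k₀ k₁ r) (List.map (Equiv.refl Γ).invFun (ea a)) =
      cfg (some p.entry) (r, Function.update (fun _ => []) k₀ (ea a)) := by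
    simp only [initList, cfg]
    congr 1
    funext k
    by_cases hk : k = k₀
    · subst k
      simp only [machine, ↓reduceDIte, Function.update_self, Equiv.refl]
      exact List.map_id _
    · exact (dif_neg hk).trans (Function.update_of_ne hk _ (fun _ => [])).symm
  have hout : haltList (p.machine k₀ k₁ r) (List.map (Equiv.refl Γ).invFun (eb (f a))) =
      (⟨none, r, Function.update (fun _ => []) k₁ (eb (f a))⟩ :
        TM2.Cfg (fun _ : K => Γ) (Option p.Pos) R) := by
    simp only [haltList]
    congr 1
    funext k
    by_cases hk : k = k₁
    · subst k
      simp only [machine, ↓reduceDIte, Function.update_self, Equiv.refl]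
      exact List.map_id _
    · exact (dif_neg hk).trans (Function.update_of_ne hk _ (fun _ => [])).symm
  refine { steps := hs.choose + 1, evals_in_steps := ?_, steps_le_m := ?_ }
  · have h2 := hs.choose_spec.2
    rw [Function.iterate_succ_apply', hin, Option.map_some, hout]
    erw [h2]
    rfl
  · have := hs.choose_spec.1
    simpa using this

end StackProg

namespace MaxDifferAffineSAT

/-! ### Stacks and registers of the kernelization -/

/-- The stacks: input, output, the parameter and a copy of it, the number of variables (passed and
remaining), a temporary stack, the current equation (in both directions), the list of vectors, the
current vector, the pivot (in both directions), the next list of vectors, and a counter. -/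
inductive Stack : Type
  | i | o | d | e | p | q | t | a | a' | b | v | u | u' | z | c
  deriving DecidableEq

instance : Fintype Stack where
  elems := {.i, .o, .d, .e, .p, .q, .t, .a, .a', .b, .v, .u, .u', .z, .c}
  complete k := by cases k <;> decide

/-- The registers: three symbols, an accumulator and a flag. -/
structure Reg where
  x : Option Symbol
  y : Option Symbol
  z : Option Symbol
  acc : ZMod 2
  fl : Bool
  deriving Fintype

/-- The contents of the stacks. -/
structure Store where
  i : List Symbol
  o : List Symbol
  d : List Symbol
  e : List Symbol
  p : List Symbol
  q : List Symbol
  t : List Symbol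
  a : List Symbol
  a' : List Symbol
  b : List Symbol
  v : List Symbol
  u : List Symbol
  u' : List Symbol
  z : List Symbol
  c : List Symbol

/-- The contents of the stacks as a function. -/
def Store.fn (s : Store) : Stack → List Symbol
  | .i => s.i | .o => s.o | .d => s.d | .e => s.e | .p => s.p | .q => s.q | .t => s.t
  | .a => s.a | .a' => s.a' | .b => s.b | .v => s.v | .u => s.u | .u' => s.u' | .z => s.z
  | .c => s.c

namespace Store

variable (s : Store) (l : List Symbol)

@[simp] theorem fn_i : s.fn .i = s.i := rfl
@[simp] theorem fn_o : s.fn .o = s.o := rfl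
@[simp] theorem fn_d : s.fn .d = s.d := rfl
@[simp] theorem fn_e : s.fn .e = s.e := rfl
@[simp] theorem fn_p : s.fn .p = s.p := rfl
@[simp] theorem fn_q : s.fn .q = s.q := rfl
@[simp] theorem fn_t : s.fn .t = s.t := rfl
@[simp] theorem fn_a : s.fn .a = s.a := rfl
@[simp] theorem fn_a' : s.fn .a' = s.a' := rfl
@[simp] theorem fn_b : s.fn .b = s.b := rfl
@[simp] theorem fn_v : s.fn .v = s.v := rfl
@[simp] theorem fn_u : s.fn .u = s.u := rfl
@[simp] theorem fn_u' : s.fn .u' = s.u' := rfl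
@[simp] theorem fn_z : s.fn .z = s.z := rfl
@[simp] theorem fn_c : s.fn .c = s.c := rfl

@[simp] theorem update_i : Function.update s.fn .i l = { s with i := l }.fn := by
  funext k; cases k <;> rfl
@[simp] theorem update_o : Function.update s.fn .o l = { s with o := l }.fn := by
  funext k; cases k <;> rfl
@[simp] theorem update_d : Function.update s.fn .d l = { s with d := l }.fn := by
  funext k; cases k <;> rfl
@[simp] theorem update_e : Function.update s.fn .e l = { s with e := l }.fn := by
  funext k; cases k <;> rfl
@[simp] theorem update_p : Function.update s.fn .p l = { s with p := l }.fn := by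
  funext k; cases k <;> rfl
@[simp] theorem update_q : Function.update s.fn .q l = { s with q := l }.fn := by
  funext k; cases k <;> rfl
@[simp] theorem update_t : Function.update s.fn .t l = { s with t := l }.fn := by
  funext k; cases k <;> rfl
@[simp] theorem update_a : Function.update s.fn .a l = { s with a := l }.fn := by
  funext k; cases k <;> rfl
@[simp] theorem update_a' : Function.update s.fn .a' l = { s with a' := l }.fn := by
  funext k; cases k <;> rfl
@[simp] theorem update_b : Function.update s.fn .b l = { s with b := l }.fn := by
  funext k; cases k <;> rfl
@[simp] theorem update_v : Function.update s.fn .v l = { s with v := l }.fn := by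
  funext k; cases k <;> rfl
@[simp] theorem update_u : Function.update s.fn .u l = { s with u := l }.fn := by
  funext k; cases k <;> rfl
@[simp] theorem update_u' : Function.update s.fn .u' l = { s with u' := l }.fn := by
  funext k; cases k <;> rfl
@[simp] theorem update_z : Function.update s.fn .z l = { s with z := l }.fn := by
  funext k; cases k <;> rfl
@[simp] theorem update_c : Function.update s.fn .c l = { s with c := l }.fn := by
  funext k; cases k <;> rfl

end Store

/-- Registers with a given accumulator and flag. -/
def reg (acc : ZMod 2) (fl : Bool) : Reg := ⟨none, none, none, acc, fl⟩

/-- The bit written in a register. -/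
def bitOf : Option Symbol → ZMod 2
  | some (.bit b) => b
  | _ => 0

@[simp] theorem bitOf_bit (b : ZMod 2) : bitOf (some (.bit b)) = b := rfl
@[simp] theorem bitOf_none : bitOf none = 0 := rfl

/-- Whether a register holds a bit. -/
def isBit : Option Symbol → Bool
  | some (.bit _) => true
  | _ => false

abbrev Prog := StackProg Stack Symbol Reg
abbrev Op := StackOp Stack Symbol Reg

/-- Pop to the register `x`. -/
def popX (k : Stack) : Op := .pop k fun r o => { r with x := o }
/-- Pop to the register `y`. -/
def popY (k : Stack) : Op := .pop k fun r o => { r with y := o }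
/-- Pop to the register `z`. -/
def popZ (k : Stack) : Op := .pop k fun r o => { r with z := o }
/-- Peek to the register `x`. -/
def peekX (k : Stack) : Op := .peek k fun r o => { r with x := o }
/-- Push a symbol computed from the registers. -/
def pushF (k : Stack) (f : Reg → Symbol) : Op := .push k (fun _ => true) f
/-- Push the register `x`. -/
def pushX (k : Stack) : Op := pushF k fun r => r.x.getD .param
/-- Push a fixed symbol. -/
def pushS (k : Stack) (a : Symbol) : Op := pushF k fun _ => a
/-- Clear the symbol registers. -/
def clr : Op := .load fun r => reg r.acc r.fl

open StackOp (execs)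
open StackProg (Runs)

section

variable (k : Stack) (r : Reg) (S : Stack → List Symbol) (l : List Op)

@[simp] theorem execs_nil (s : Reg × (Stack → List Symbol)) : execs ([] : List Op) s = s := rfl
@[simp] theorem execs_popX : execs (popX k :: l) (r, S) =
    execs l ({ r with x := (S k).head? }, Function.update S k (S k).tail) := rfl
@[simp] theorem execs_popY : execs (popY k :: l) (r, S) =
    execs l ({ r with y := (S k).head? }, Function.update S k (S k).tail) := rfl
@[simp] theorem execs_popZ : execs (popZ k :: l) (r, S) =
    execs l ({ r with z := (S k).head? }, Function.update S k (S k).tail) := rfl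
@[simp] theorem execs_peekX : execs (peekX k :: l) (r, S) =
    execs l ({ r with x := (S k).head? }, S) := rfl
@[simp] theorem execs_pushF (f : Reg → Symbol) : execs (pushF k f :: l) (r, S) =
    execs l (r, Function.update S k (f r :: S k)) := rfl
@[simp] theorem execs_pushX : execs (pushX k :: l) (r, S) =
    execs l (r, Function.update S k (r.x.getD .param :: S k)) := rfl
@[simp] theorem execs_pushS (a : Symbol) : execs (pushS k a :: l) (r, S) =
    execs l (r, Function.update S k (a :: S k)) := rfl
@[simp] theorem execs_push (c : Reg → Bool) (f : Reg → Symbol) :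
    execs (StackOp.push k c f :: l) (r, S) =
    execs l (r, if c r then Function.update S k (f r :: S k) else S) := rfl
@[simp] theorem execs_load (f : Reg → Reg) :
    execs (StackOp.load f :: l) (r, S) = execs l (f r, S) := rfl
@[simp] theorem execs_clr : execs (clr :: l) (r, S) = execs l (reg r.acc r.fl, S) := rfl

end

section

variable {p q : Prog} {pre : List Op} {cond : Reg → Bool} {s s' s₁ s₂ : Reg × (Stack → List Symbol)}
  {t t' : ℕ}

theorem runs_block {ops : List Op} (h : execs ops s = s') : Runs (.block ops) s s' 1 :=
  h ▸ .block ops s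

theorem runs_of_eq (h : Runs p s s₁ t) (hs : s₁ = s') (ht : t ≤ t') : Runs p s s' t' :=
  hs ▸ h.mono ht

theorem runs_loop_exit (h : execs pre s = s') (hc : cond s'.1 = false) :
    Runs (.loop pre cond p) s s' 1 := by
  subst h
  exact .loop_exit hc

theorem runs_loop_step (h : execs pre s = s₁) (hc : cond s₁.1 = true) (hp : Runs p s₁ s₂ t)
    (hl : Runs (.loop pre cond p) s₂ s' t') : Runs (.loop pre cond p) s s' (t' + (t + 1)) := by
  subst h
  exact .loop_step hc hp hl

end

/-- Whether the register `x` is nonempty. -/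
def someX (r : Reg) : Bool := r.x.isSome

/-- Move a stack to another one, upside down. -/
def move (k l : Stack) : Prog := .loop [popX k] someX (.block [pushX l])

theorem runs_move {k l : Stack} (hkl : k ≠ l) (acc : ZMod 2) (fl : Bool)
    (S : Stack → List Symbol) (y : List Symbol) (hy : S k = y) :
    Runs (move k l) (reg acc fl, S)
      (reg acc fl, Function.update (Function.update S k []) l (y.reverse ++ S l))
      (2 * y.length + 1) := by
  -- Every round leaves the last popped symbol in the register `x`, so the induction must allow an
  -- arbitrary initial `x`.
  suffices H : ∀ x, Runs (move k l) (⟨x, none, none, acc, fl⟩, S)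
      (reg acc fl, Function.update (Function.update S k []) l (y.reverse ++ S l))
      (2 * y.length + 1) from H none
  induction y generalizing S with
  | nil =>
    intro x
    refine runs_of_eq (runs_loop_exit rfl ?_) ?_ (by simp) <;> simp [someX, hy]
    refine ⟨rfl, ?_⟩
    rw [Function.update_of_ne hkl.symm]
  | cons a y ih =>
    intro x
    refine runs_of_eq (runs_loop_step rfl ?_ (runs_block rfl) (ih _ ?_ _)) ?_ ?_
    · simp [someX, hy]
    · simp [hy, hkl]
    · simp [hy, hkl.symm]
      funext j
      by_cases h1 : j = l
      · subst h1; simp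
      · by_cases h2 : j = k
        · subst h2; simp [hkl]
        · simp [h1, h2]
    · simp; omega

/-- Empty a stack. -/
def clear (k : Stack) : Prog := .loop [popX k] someX (.block [])

theorem runs_clear (k : Stack) (acc : ZMod 2) (fl : Bool)
    (S : Stack → List Symbol) (y : List Symbol) (hy : S k = y) :
    Runs (clear k) (reg acc fl, S) (reg acc fl, Function.update S k []) (2 * y.length + 1) := by
  suffices H : ∀ x, Runs (clear k) (⟨x, none, none, acc, fl⟩, S)
      (reg acc fl, Function.update S k []) (2 * y.length + 1) from H none
  induction y generalizing S with
  | nil =>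
    intro x
    refine runs_of_eq (runs_loop_exit rfl ?_) ?_ (by simp) <;> simp [someX, hy, reg]
  | cons a y ih =>
    intro x
    refine runs_of_eq (runs_loop_step rfl ?_ (runs_block rfl) (ih _ ?_ _)) ?_ ?_
    · simp [someX, hy]
    · simp [hy]
    · simp
    · simp; omega

/-! ### Sweeping over a list of vectors -/

/-- Corresponding entries of the current equation, the current vector and the pivot. -/
abbrev Entry := ZMod 2 × ZMod 2 × ZMod 2

/-- One direction of a sweep: compute the product with the current equation. -/
def dotPass : Prog :=
  .loop [popX .a] someX (.block [popY .b, popZ .u',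
    .load fun r => { r with acc := r.acc + bitOf r.x * bitOf r.y }, pushX .a',
    pushF .v fun r => r.y.getD .param, pushF .u fun r => .bit (bitOf r.z), clr])

/-- Each round moves one symbol per stack, so the copies arrive upside down. An empty pivot stack
stands for the zero vector: popping it yields `none`, which `bitOf` reads as 0, and the copy is then
written out in full. -/
theorem runs_dotPass (l : List Entry) (acc : ZMod 2) (fl : Bool) (s : Store)
    (y : List Symbol) (ha : s.a = l.map fun p : Entry => Symbol.bit p.1)
    (hb : s.b = (l.map fun p : Entry => Symbol.bit p.2.1) ++ y)
    (hu : s.u' = (l.map fun p : Entry => Symbol.bit p.2.2) ∨ s.u' = [] ∧ ∀ p ∈ l, p.2.2 = 0) :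
    Runs dotPass (reg acc fl, s.fn) (reg (acc + (l.map fun p => p.1 * p.2.1).sum) fl,
      { s with
        a := []
        b := y
        u' := []
        a' := (l.map fun p : Entry => Symbol.bit p.1).reverse ++ s.a'
        v := (l.map fun p : Entry => Symbol.bit p.2.1).reverse ++ s.v
        u := (l.map fun p : Entry => Symbol.bit p.2.2).reverse ++ s.u }.fn) (2 * l.length + 1) := by
  induction l generalizing s acc with
  | nil =>
    have hu : s.u' = [] := by simpa using hu
    refine runs_of_eq (runs_loop_exit rfl ?_) ?_ (by simp)
    · simp [someX, ha]
    · rcases s with ⟨⟩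
      simp_all [reg]
  | cons p l ih =>
    have hz : bitOf s.u'.head? = p.2.2 := by
      rcases hu with hu | ⟨hu, h0⟩
      · simp [hu]
      · simp [hu, h0 p]
    refine runs_of_eq (runs_loop_step rfl ?_ (runs_block ?_) (ih (acc + p.1 * p.2.1)
      { s with
        a := s.a.tail
        b := s.b.tail
        u' := s.u'.tail
        a' := .bit p.1 :: s.a'
        v := .bit p.2.1 :: s.v
        u := .bit p.2.2 :: s.u } ?_ ?_ ?_)) ?_ ?_
    · simp [someX, ha]
    · simp [ha, hb, hz, reg]
    · simp [ha]
    · simp [hb]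
    · rcases hu with hu | ⟨hu, h0⟩
      · simp [hu]
      · exact Or.inr ⟨by simp [hu], fun p hp => h0 p (by simp [hp])⟩
    · simp [add_assoc]
    · simp; omega

/-- The other direction of a sweep: update the pivot and write the next vector. -/
def combPass (g : Bool → ZMod 2 → ZMod 2 → ZMod 2 → ZMod 2)
    (h : Bool → ZMod 2 → ZMod 2 → ZMod 2 → Option (ZMod 2)) : Prog :=
  .loop [popX .a'] someX (.block [popY .v, popZ .u, pushX .a,
    pushF .u' fun r => .bit (g r.fl r.acc (bitOf r.y) (bitOf r.z)),
    .push .z (fun r => (h r.fl r.acc (bitOf r.y) (bitOf r.z)).isSome)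
      (fun r => .bit ((h r.fl r.acc (bitOf r.y) (bitOf r.z)).getD 0)), clr])

/-- Run after `dotPass`, this reads the reversed copies, so that everything regains its orientation,
and `acc` already holds the complete product. A value `none` of `h` deletes the coordinate from the
new row. -/
theorem runs_combPass (g : Bool → ZMod 2 → ZMod 2 → ZMod 2 → ZMod 2)
    (h : Bool → ZMod 2 → ZMod 2 → ZMod 2 → Option (ZMod 2))
    (l : List Entry) (acc : ZMod 2) (fl : Bool) (s : Store)
    (ha : s.a' = l.map fun p : Entry => Symbol.bit p.1)
    (hv : s.v = l.map fun p : Entry => Symbol.bit p.2.1)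
    (hu : s.u = l.map fun p : Entry => Symbol.bit p.2.2) :
    Runs (combPass g h) (reg acc fl, s.fn) (reg acc fl,
      { s with
        a' := []
        v := []
        u := []
        a := (l.map fun p : Entry => Symbol.bit p.1).reverse ++ s.a
        u' := (l.map fun p : Entry => Symbol.bit (g fl acc p.2.1 p.2.2)).reverse ++ s.u'
        z := ((l.filterMap fun p : Entry => h fl acc p.2.1 p.2.2).map Symbol.bit).reverse ++
          s.z }.fn)
      (2 * l.length + 1) := by
  induction l generalizing s with
  | nil =>
    refine runs_of_eq (runs_loop_exit rfl ?_) ?_ (by simp)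
    · simp [someX, ha]
    · rcases s with ⟨⟩
      simp_all [reg]
  | cons p l ih =>
    refine runs_of_eq (runs_loop_step rfl ?_ (runs_block ?_) (ih
      { s with
        a' := s.a'.tail
        v := s.v.tail
        u := s.u.tail
        a := .bit p.1 :: s.a
        u' := .bit (g fl acc p.2.1 p.2.2) :: s.u'
        z := ((h fl acc p.2.1 p.2.2).toList.map .bit) ++ s.z } ?_ ?_ ?_)) ?_ ?_
    · simp [someX, ha]
    · cases hh : h fl acc p.2.1 p.2.2 <;> simp [ha, hv, hu, reg, hh]
    · simp [ha]
    · simp [hv]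
    · simp [hu]
    · cases hh : h fl acc p.2.1 p.2.2 <;> simp [hh]
    · simp; omega

end MaxDifferAffineSAT

/-! ### Sweeps as folds over lists of vectors -/

namespace MaxDifferAffineSAT
open StackOp (execs)
open StackProg (Runs)

/-- Rows written on a stack, each with a marker on top. -/
def enc (rows : List (List (ZMod 2))) : List Symbol :=
  rows.flatMap fun r => Symbol.eqn :: r.map Symbol.bit

/-- Vectors written on a stack. -/
def encVecs {w : ℕ} (vs : List (Fin w → ZMod 2)) : List Symbol := enc (vs.map List.ofFn)

/-- The stack contents `l` represent the vector `u`; nothing at all represents the zero vector. -/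
def Represents {w : ℕ} (l : List Symbol) (u : Fin w → ZMod 2) : Prop :=
  l = (List.ofFn u).map Symbol.bit ∨ l = [] ∧ u = 0

/-- The effect of a sweep on the flag, the pivot and the next list of rows. -/
def sweepStep (g : Bool → ZMod 2 → ZMod 2 → ZMod 2 → ZMod 2)
    (h : Bool → ZMod 2 → ZMod 2 → ZMod 2 → Option (ZMod 2)) {w : ℕ} (a : Fin w → ZMod 2)
    (s : Bool × (Fin w → ZMod 2) × List (List (ZMod 2))) (v : Fin w → ZMod 2) :
    Bool × (Fin w → ZMod 2) × List (List (ZMod 2)) :=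
  (s.1 || decide (a ⬝ᵥ v ≠ 0), fun i => g s.1 (a ⬝ᵥ v) (v i) (s.2.1 i),
    ((List.finRange w).filterMap fun i => h s.1 (a ⬝ᵥ v) (v i) (s.2.1 i)) :: s.2.2)

/-- Sweep over the list of vectors. -/
def sweep (g : Bool → ZMod 2 → ZMod 2 → ZMod 2 → ZMod 2)
    (h : Bool → ZMod 2 → ZMod 2 → ZMod 2 → Option (ZMod 2)) : Prog :=
  .loop [popX .b] someX (.seq (.block [.load fun r => reg 0 r.fl])
    (.seq dotPass (.seq (combPass g h)
      (.block [pushS .z .eqn, .load fun r => reg 0 (r.fl || decide (r.acc ≠ 0))]))))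

/-- The forward and backward passes restore `a` for the next vector. Finished rows are stacked on
`z`, so the list comes out reversed, as in a fold with cons. The cost 4w + 5 per vector is two
passes of 2w + 1 steps, two blocks and the loop test. -/
theorem runs_sweep (g : Bool → ZMod 2 → ZMod 2 → ZMod 2 → ZMod 2)
    (h : Bool → ZMod 2 → ZMod 2 → ZMod 2 → Option (ZMod 2)) {w : ℕ} (a u : Fin w → ZMod 2)
    (vs : List (Fin w → ZMod 2)) (out : List (List (ZMod 2))) (fl : Bool) (s : Store)
    (ha : s.a = (List.ofFn a).map Symbol.bit) (hb : s.b = encVecs vs) (hu : Represents s.u' u)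
    (ha' : s.a' = []) (hv : s.v = []) (hU : s.u = []) (hz : s.z = enc out) :
    ∃ l, Represents l (vs.foldl (sweepStep g h a) (fl, u, out)).2.1 ∧
      Runs (sweep g h) (reg 0 fl, s.fn)
        (reg 0 (vs.foldl (sweepStep g h a) (fl, u, out)).1,
          { s with
            b := []
            u' := l
            z := enc (vs.foldl (sweepStep g h a) (fl, u, out)).2.2 }.fn)
        (vs.length * (4 * w + 5) + 1) := by
  induction vs generalizing s fl u out with
  | nil =>
    refine ⟨s.u', hu, runs_of_eq (runs_loop_exit rfl ?_) ?_ (by simp)⟩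
    · simp [someX, hb, encVecs, enc]
    · rcases s with ⟨⟩
      simp_all [reg, encVecs, enc]
  | cons v vs ih =>
    set l : List Entry := List.ofFn fun i => (a i, v i, u i) with hl
    have hsum : (l.map fun p : Entry => p.1 * p.2.1).sum = a ⬝ᵥ v := by
      simp [hl, List.map_ofFn, List.sum_ofFn, dotProduct, Function.comp_def]
    have hfm : l.filterMap (fun p : Entry => h fl (a ⬝ᵥ v) p.2.1 p.2.2) =
        (List.finRange w).filterMap fun i => h fl (a ⬝ᵥ v) (v i) (u i) := by
      simp [hl, List.ofFn_eq_map, List.filterMap_map]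
    obtain ⟨l', hl', hrun⟩ := ih (fun i => g fl (a ⬝ᵥ v) (v i) (u i))
      (((List.finRange w).filterMap fun i => h fl (a ⬝ᵥ v) (v i) (u i)) :: out)
      (fl || decide (a ⬝ᵥ v ≠ 0))
      { s with
        b := encVecs vs
        u' := (List.ofFn fun i => g fl (a ⬝ᵥ v) (v i) (u i)).map Symbol.bit
        z := enc (((List.finRange w).filterMap fun i => h fl (a ⬝ᵥ v) (v i) (u i)) :: out) }
      ha rfl (Or.inl rfl) ha' hv hU rfl
    refine ⟨l', hl', ?_⟩
    have h1 := runs_dotPass l 0 fl { s with b := s.b.tail } (encVecs vs)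
      (by simp [ha, hl, List.map_ofFn, Function.comp_def])
      (by simp [hb, encVecs, enc, hl, List.map_ofFn, Function.comp_def])
      (by
        rcases hu with hu | ⟨hu, h0⟩
        · exact Or.inl (by simp [hu, hl, List.map_ofFn, Function.comp_def])
        · exact Or.inr ⟨hu, by simp [hl, h0, List.mem_ofFn]⟩)
    rw [zero_add, hsum] at h1
    have h2 := runs_combPass g h l.reverse (a ⬝ᵥ v) fl
      { s with
        b := encVecs vs
        a := []
        u' := []
        a' := (l.map fun p : Entry => Symbol.bit p.1).reverse
        v := (l.map fun p : Entry => Symbol.bit p.2.1).reverse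
        u := (l.map fun p : Entry => Symbol.bit p.2.2).reverse }
      (by simp) (by simp) (by simp)
    have hlen : l.length = w := by simp [hl]
    have hpre : execs [popX .b] (reg 0 fl, s.fn) =
        (⟨some .eqn, none, none, 0, fl⟩, { s with b := s.b.tail }.fn) := by
      simp [hb, encVecs, enc, reg]
    refine runs_of_eq (runs_loop_step (t := 1 + (2 * l.length + 1 + (2 * l.length + 1 + 1)))
      hpre rfl ?_ hrun) rfl ?_
    · refine .seq (runs_block (s' := (reg 0 fl, { s with b := s.b.tail }.fn)) rfl)
        (.seq (runs_of_eq h1 ?_ le_rfl) (.seq (runs_of_eq h2 rfl (by simp)) (runs_block ?_)))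
      · simp [ha', hv, hU]
      · simp only [execs_pushS, execs_load, execs_nil, Store.update_z, Store.fn_z]
        rw [hl] at hfm
        simp [hfm, hz, ha', hv, hU, hl, ha, enc, reg, List.map_ofFn, Function.comp_def]
        by_cases h0 : a ⬝ᵥ v = 0 <;> simp [h0]
    · simp only [hlen, List.length_cons]
      ring_nf
      omega

end MaxDifferAffineSAT

namespace MaxDifferAffineSAT

/-! ### Linear algebra over the two-element field -/

theorem zmod_two_eq_one {x : ZMod 2} (h : x ≠ 0) : x = 1 := by
  revert h; revert x; decide

/-- The span of a list of vectors. -/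
def spanList {w : ℕ} (vs : List (Fin w → ZMod 2)) : Submodule (ZMod 2) (Fin w → ZMod 2) :=
  Submodule.span (ZMod 2) {x | x ∈ vs}

theorem spanList_cons {w : ℕ} (v : Fin w → ZMod 2) (vs : List (Fin w → ZMod 2)) :
    spanList (v :: vs) = Submodule.span (ZMod 2) {v} ⊔ spanList vs := by
  rw [spanList, spanList, ← Submodule.span_insert]
  congr 1
  ext x
  simp

theorem spanList_reverse {w : ℕ} (vs : List (Fin w → ZMod 2)) :
    spanList vs.reverse = spanList vs := by
  simp [spanList]

theorem subset_spanList {w : ℕ} {v : Fin w → ZMod 2} {vs : List (Fin w → ZMod 2)} (h : v ∈ vs) :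
    v ∈ spanList vs := Submodule.subset_span h

theorem spanList_induction_zero {w : ℕ} {vs : List (Fin w → ZMod 2)}
    (f : (Fin w → ZMod 2) →ₗ[ZMod 2] ZMod 2) (h : ∀ v ∈ vs, f v = 0) {x : Fin w → ZMod 2}
    (hx : x ∈ spanList vs) : f x = 0 :=
  (Submodule.span_le.2 (fun v hv => h v hv) : spanList vs ≤ LinearMap.ker f) hx

theorem dotProduct_eq_zero_of_spanList {w : ℕ} {vs : List (Fin w → ZMod 2)} (a : Fin w → ZMod 2)
    (h : ∀ v ∈ vs, a ⬝ᵥ v = 0) {x : Fin w → ZMod 2} (hx : x ∈ spanList vs) : a ⬝ᵥ x = 0 :=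
  spanList_induction_zero (dotProductBilin (ZMod 2) (ZMod 2) a) h hx

/-- How elimination changes the pivot. -/
def elimG (fl : Bool) (t x y : ZMod 2) : ZMod 2 := if t ≠ 0 ∧ fl = false then x else y

/-- How elimination changes a vector. -/
def elimH (fl : Bool) (t x y : ZMod 2) : Option (ZMod 2) :=
  some (if t = 0 then x else if fl then x + y else 0)

/-- The invariant of elimination. -/
def ElimInv {w : ℕ} (a : Fin w → ZMod 2) (ps : List (Fin w → ZMod 2))
    (s : Bool × (Fin w → ZMod 2) × List (List (ZMod 2))) : Prop :=
  ∃ out : List (Fin w → ZMod 2), s.2.2 = out.map List.ofFn ∧ out.length = ps.length ∧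
    (s.1 = true ↔ ∃ v ∈ ps, a ⬝ᵥ v ≠ 0) ∧ (∀ v ∈ out, a ⬝ᵥ v = 0) ∧
    (s.1 = true → a ⬝ᵥ s.2.1 = 1 ∧
      Submodule.span (ZMod 2) {s.2.1} ⊔ spanList out = spanList ps) ∧
    (s.1 = false → spanList out = spanList ps)

/-- If a · v = 0, then v is kept. If the product is 1 and there is a pivot u, then v + u is
orthogonal to a and spans, together with u, the same space as u and v. If there is no pivot yet, v
becomes the pivot and a zero vector fills its place to preserve the length. -/
theorem ElimInv.step {w : ℕ} {a : Fin w → ZMod 2} {ps : List (Fin w → ZMod 2)}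
    {s : Bool × (Fin w → ZMod 2) × List (List (ZMod 2))} (h : ElimInv a ps s)
    (v : Fin w → ZMod 2) : ElimInv a (v :: ps) (sweepStep elimG elimH a s v) := by
  obtain ⟨fl, u, o⟩ := s
  obtain ⟨out, ho, hlen, hfl, hker, ht, hf⟩ := h
  dsimp only at ho hfl ht hf
  have key : ∀ f : Fin w → ZMod 2,
      ((List.finRange w).filterMap fun i => some (f i)) = List.ofFn f := fun f => by
    rw [List.ofFn_eq_map, List.filterMap_eq_map']
  by_cases h0 : a ⬝ᵥ v = 0
  · refine ⟨v :: out, ?_, by simp [hlen], ?_, ?_, ?_, ?_⟩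
    · simp [sweepStep, elimH, h0, key, ho]
    · simp [sweepStep, h0, hfl]
    · simpa [h0] using hker
    · intro h1
      have h1 : fl = true := by simpa [sweepStep, h0] using h1
      refine ⟨by simpa [sweepStep, elimG, h0] using (ht h1).1, ?_⟩
      rw [spanList_cons, spanList_cons, ← (ht h1).2]
      simp only [sweepStep, elimG, h0, ne_eq, not_true_eq_false, false_and, if_false]
      exact sup_left_comm _ _ _
    · intro h1
      have h1 : fl = false := by simpa [sweepStep, h0] using h1
      rw [spanList_cons, spanList_cons, hf h1]
  · have hv1 : a ⬝ᵥ v = 1 := zmod_two_eq_one h0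
    cases fl with
    | true =>
      obtain ⟨hu1, hsp⟩ := ht rfl
      refine ⟨(v + u) :: out, ?_, by simp [hlen], ?_, ?_, ?_, ?_⟩
      · simp [sweepStep, elimH, hv1, key, ho]
        rfl
      · simp [sweepStep, h0]
      · have : a ⬝ᵥ (v + u) = 0 := by
          rw [dotProduct_add, hv1, hu1]; decide
        simpa [this] using hker
      · intro _
        refine ⟨by simpa [sweepStep, elimG] using hu1, ?_⟩
        rw [spanList_cons, spanList_cons, ← hsp]
        simp only [sweepStep, elimG, Bool.true_eq_false, and_false, if_false]
        rw [← sup_assoc, ← sup_assoc, sup_comm (Submodule.span _ {v})]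
        congr 1
        apply le_antisymm
        · refine sup_le le_sup_left ?_
          rw [Submodule.span_singleton_le_iff_mem]
          exact add_mem (Submodule.mem_sup_right (Submodule.mem_span_singleton_self v))
            (Submodule.mem_sup_left (Submodule.mem_span_singleton_self u))
        · refine sup_le le_sup_left ?_
          rw [Submodule.span_singleton_le_iff_mem]
          have := sub_mem (Submodule.mem_sup_right (Submodule.mem_span_singleton_self (v + u)))
            (Submodule.mem_sup_left (T := Submodule.span (ZMod 2) {v + u})
              (Submodule.mem_span_singleton_self (R := ZMod 2) u))
          rwa [add_sub_cancel_right] at this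
      · intro h1
        simp [sweepStep] at h1
    | false =>
      refine ⟨0 :: out, ?_, by simp [hlen], ?_, ?_, ?_, ?_⟩
      · simp [sweepStep, elimH, hv1, key, ho, -List.ofFn_const]
        rfl
      · simp [sweepStep, h0]
      · simpa using hker
      · intro _
        refine ⟨by simpa [sweepStep, elimG, h0] using hv1, ?_⟩
        rw [spanList_cons, spanList_cons, hf rfl]
        simp [sweepStep, elimG, h0]
      · intro h1
        simp [sweepStep, h0] at h1

/-- With a pivot u, the old span consists of the vectors c u + z with z in the new span; such a
vector has product c with a, so it is orthogonal to a iff c = 0. Without a pivot, a vanishes on the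
whole span. The initial `u` is arbitrary because the invariant speaks of the pivot only once the
flag is set. -/
theorem elim_spec {w : ℕ} (a u : Fin w → ZMod 2) (vs : List (Fin w → ZMod 2)) :
    ∃ vs' : List (Fin w → ZMod 2),
      (vs.foldl (sweepStep elimG elimH a) (false, u, [])).2.2 = vs'.map List.ofFn ∧
      vs'.length = vs.length ∧
      ((vs.foldl (sweepStep elimG elimH a) (false, u, [])).1 = true ↔ ∃ v ∈ vs, a ⬝ᵥ v ≠ 0) ∧
      ∀ x, x ∈ spanList vs' ↔ x ∈ spanList vs ∧ a ⬝ᵥ x = 0 := by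
  have H : ∀ (vs ps : List (Fin w → ZMod 2)) s, ElimInv a ps s →
      ElimInv a (vs.reverse ++ ps) (vs.foldl (sweepStep elimG elimH a) s) := by
    intro vs
    induction vs with
    | nil => exact fun ps s h => h
    | cons v vs ih =>
      intro ps s h
      simpa using ih _ _ (h.step v)
  have := H vs [] (false, u, []) ⟨[], by simp⟩
  generalize vs.foldl (sweepStep elimG elimH a) (false, u, []) = s at this ⊢
  obtain ⟨out, ho, hlen, hfl, hker, ht, hf⟩ := this
  rw [List.append_nil, spanList_reverse] at ht hf
  refine ⟨out, ho, by simpa using hlen, by simpa using hfl, fun x => ?_⟩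
  cases h1 : s.1 with
  | false =>
    rw [hf h1]
    refine ⟨fun hx => ⟨hx, ?_⟩, fun hx => hx.1⟩
    rw [← hf h1] at hx
    exact dotProduct_eq_zero_of_spanList a hker hx
  | true =>
    obtain ⟨hu, hsp⟩ := ht h1
    rw [← hsp]
    refine ⟨fun hx => ⟨Submodule.mem_sup_right hx, dotProduct_eq_zero_of_spanList a hker hx⟩, ?_⟩
    rintro ⟨hx, h0⟩
    obtain ⟨y, hy, z, hz, rfl⟩ := Submodule.mem_sup.1 hx
    obtain ⟨c, rfl⟩ := Submodule.mem_span_singleton.1 hy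
    rw [dotProduct_add, dotProduct_eq_zero_of_spanList a hker hz, dotProduct_smul, hu] at h0
    have : c = 0 := by simpa using h0
    simpa [this] using hz

/-- How the mask of the nonzero coordinates changes. -/
def maskG (_ : Bool) (_ x y : ZMod 2) : ZMod 2 := if x = 0 then y else x

/-- The mask leaves the vectors unchanged. -/
def maskH (_ : Bool) (_ x _ : ZMod 2) : Option (ZMod 2) := some x

/-- The pivot slot serves as an accumulator for the union of the supports; the products with `a`
influence neither the mask nor the rows. -/
theorem mask_spec {w : ℕ} (a : Fin w → ZMod 2) (vs : List (Fin w → ZMod 2))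
    (s : Bool × (Fin w → ZMod 2) × List (List (ZMod 2))) :
    (vs.foldl (sweepStep maskG maskH a) s).2.2 = vs.reverse.map List.ofFn ++ s.2.2 ∧
    ∀ i, (vs.foldl (sweepStep maskG maskH a) s).2.1 i ≠ 0 ↔ s.2.1 i ≠ 0 ∨ ∃ v ∈ vs, v i ≠ 0 := by
  induction vs generalizing s with
  | nil => simp
  | cons v vs ih =>
    obtain ⟨h1, h2⟩ := ih (sweepStep maskG maskH a s v)
    refine ⟨?_, fun i => ?_⟩
    · rw [List.foldl_cons, h1]
      simp [sweepStep, maskH, List.ofFn_eq_map]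
    · rw [List.foldl_cons, h2]
      by_cases hi : v i = 0 <;> simp [sweepStep, maskG, hi]

/-- Restriction leaves the mask unchanged. -/
def restrG (_ : Bool) (_ _ y : ZMod 2) : ZMod 2 := y

/-- Restriction keeps the coordinates of the mask. -/
def restrH (_ : Bool) (_ x y : ZMod 2) : Option (ZMod 2) := if y = 0 then none else some x

/-- The coordinates of a mask. -/
def maskList {w : ℕ} (u : Fin w → ZMod 2) : List (Fin w) := (List.finRange w).filter (u · ≠ 0)

theorem restr_spec {w : ℕ} (a : Fin w → ZMod 2) (vs : List (Fin w → ZMod 2))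
    (s : Bool × (Fin w → ZMod 2) × List (List (ZMod 2))) :
    (vs.foldl (sweepStep restrG restrH a) s).2.2 =
      (vs.reverse.map fun v => List.ofFn fun j => v ((maskList s.2.1).get j)) ++ s.2.2 ∧
    (vs.foldl (sweepStep restrG restrH a) s).2.1 = s.2.1 := by
  induction vs generalizing s with
  | nil => simp
  | cons v vs ih =>
    obtain ⟨h1, h2⟩ := ih (sweepStep restrG restrH a s v)
    have h3 : (sweepStep restrG restrH a s v).2.1 = s.2.1 := rfl
    have h4 : ((List.finRange w).filterMap fun i => restrH s.1 (a ⬝ᵥ v) (v i) (s.2.1 i)) =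
        List.ofFn fun j => v ((maskList s.2.1).get j) := by
      have : (List.ofFn fun j => v ((maskList s.2.1).get j)) = (maskList s.2.1).map v := by
        conv_rhs => rw [← List.ofFn_get (maskList s.2.1), List.map_ofFn]
        rfl
      rw [this, maskList]
      generalize List.finRange w = l
      induction l with
      | nil => rfl
      | cons i l ih => by_cases hi : s.2.1 i = 0 <;> simp [restrH, hi] <;> simpa [restrH] using ih
    refine ⟨?_, ?_⟩
    · rw [List.foldl_cons, h1, h3]
      simp [sweepStep, h4]
    · rw [List.foldl_cons, h2, h3]

/-- Double orthogonal complement: a functional vanishing on S but not at x is the dot product with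
its values on the standard basis. -/
theorem mem_of_dotProduct {m : ℕ} (S : Submodule (ZMod 2) (Fin m → ZMod 2)) (x : Fin m → ZMod 2) :
    x ∈ S ↔ ∀ y, (∀ v ∈ S, v ⬝ᵥ y = 0) → y ⬝ᵥ x = 0 := by
  refine ⟨fun hx y hy => by rw [dotProduct_comm]; exact hy x hx, fun h => ?_⟩
  by_contra hx
  obtain ⟨f, hf, hS⟩ := Submodule.exists_le_ker_of_notMem hx
  refine hf ?_
  have key : ∀ v, f v = v ⬝ᵥ fun i => f fun j => if i = j then 1 else 0 := fun v => by
    rw [LinearMap.pi_apply_eq_sum_univ f v]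
    simp [dotProduct]
  rw [key, dotProduct_comm]
  exact h _ fun v hv => by rw [← key]; exact hS hv

/-- Averaging: each coordinate in T is nonzero on exactly half of S, so the weights of the vectors
of S add up to at least |T| |S| / 2. -/
theorem exists_le_hammingNorm {w : ℕ} (S : Submodule (ZMod 2) (Fin w → ZMod 2))
    (T : Finset (Fin w)) (hT : ∀ i ∈ T, ∃ v ∈ S, v i ≠ 0) :
    ∃ x ∈ S, T.card ≤ 2 * hammingNorm x := by
  classical
  have half : ∀ i ∈ T, 2 * (Finset.univ.filter fun x : S => (x : Fin w → ZMod 2) i ≠ 0).card =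
      Fintype.card S := by
    intro i hi
    obtain ⟨v, hv, hvi⟩ := hT i hi
    have hvi := zmod_two_eq_one hvi
    have : (Finset.univ.filter fun x : S => (x : Fin w → ZMod 2) i ≠ 0).card =
        (Finset.univ.filter fun x : S => ¬ (x : Fin w → ZMod 2) i ≠ 0).card := by
      -- Translation by v flips coordinate i and so exchanges the two halves of S.
      refine Finset.card_equiv (Equiv.addRight ⟨v, hv⟩) fun x => ?_
      have h2 : ∀ y : ZMod 2, y ≠ 0 ↔ y + 1 = 0 := by decide
      simp [hvi]
      exact h2 _
    have h3 := Finset.card_filter_add_card_filter_not (s := Finset.univ)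
      (fun x : S => (x : Fin w → ZMod 2) i ≠ 0)
    rw [← this, Finset.card_univ] at h3
    omega
  by_contra! hcon
  have h1 : ∑ x : S, 2 * hammingNorm (x : Fin w → ZMod 2) < ∑ _x : S, T.card :=
    Finset.sum_lt_sum_of_nonempty Finset.univ_nonempty fun x _ => hcon x x.2
  have h2 : ∑ i ∈ T, 2 * (Finset.univ.filter fun x : S => (x : Fin w → ZMod 2) i ≠ 0).card ≤
      ∑ x : S, 2 * hammingNorm (x : Fin w → ZMod 2) := by
    simp_rw [Finset.card_filter, Finset.mul_sum]
    rw [Finset.sum_comm]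
    refine Finset.sum_le_sum fun x _ => ?_
    rw [← Finset.mul_sum, ← Finset.card_filter, hammingNorm]
    gcongr
    exact Finset.subset_univ _
  rw [Finset.sum_congr rfl half] at h2
  simp at h1 h2
  rw [mul_comm] at h1
  exact absurd (h2.trans_lt h1) (lt_irrefl _)

end MaxDifferAffineSAT

namespace MaxDifferAffineSAT
open StackOp (execs)
open StackProg (Runs)

/-! ### The parts of the program -/

theorem length_enc {rows : List (List (ZMod 2))} {w : ℕ} (h : ∀ r ∈ rows, r.length = w) :
    (enc rows).length = rows.length * (w + 1) := by
  induction rows with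
  | nil => simp [enc]
  | cons r rows ih =>
    have := ih fun r' hr' => h r' (by simp [hr'])
    simp only [enc, List.flatMap_cons, List.length_append, List.length_cons, List.length_map,
      h r (by simp)] at this ⊢
    rw [this]
    ring

theorem length_encVecs {w : ℕ} (vs : List (Fin w → ZMod 2)) :
    (encVecs vs).length = vs.length * (w + 1) := by
  rw [encVecs, length_enc (w := w)]
  · simp
  · simp

theorem isBit_head?_encVecs {w : ℕ} (vs : List (Fin w → ZMod 2)) :
    isBit (encVecs vs).head? = false := by
  cases vs <;> rfl

/-- Move the symbols satisfying a condition from the top of a stack to another stack. -/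
def take (c : Option Symbol → Bool) (k l : Stack) : Prog :=
  .seq (.loop [peekX k] (fun r => c r.x) (.block [popX k, pushX l])) (.block [clr])

theorem runs_take {c : Option Symbol → Bool} {k l : Stack} (hkl : k ≠ l) (acc : ZMod 2) (fl : Bool)
    (S : Stack → List Symbol) (x y : List Symbol) (hS : S k = x ++ y)
    (hx : ∀ a ∈ x, c (some a) = true) (hy : c y.head? = false) :
    Runs (take c k l) (reg acc fl, S)
      (reg acc fl, Function.update (Function.update S k y) l (x.reverse ++ S l))
      (2 * x.length + 2) := by
  suffices H : ∀ o, Runs (.loop [peekX k] (fun r => c r.x) (.block [popX k, pushX l]))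
      (⟨o, none, none, acc, fl⟩, S)
      (⟨y.head?, none, none, acc, fl⟩,
        Function.update (Function.update S k y) l (x.reverse ++ S l)) (2 * x.length + 1) from
    runs_of_eq (.seq (H none) (runs_block rfl)) rfl (by omega)
  induction x generalizing S with
  | nil =>
    intro o
    refine runs_of_eq (runs_loop_exit rfl ?_) ?_ (by simp)
    · simpa [hS] using hy
    · rw [List.nil_append] at hS
      rw [List.reverse_nil, List.nil_append, ← hS, Function.update_eq_self, Function.update_eq_self]
      rfl
  | cons a x ih =>
    intro o
    refine runs_of_eq (runs_loop_step rfl ?_ (runs_block rfl) (ih _ ?_ ?_ _)) ?_ ?_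
    · simpa [hS] using hx a (by simp)
    · simp [hS, hkl, StackOp.exec, popX]
    · exact fun b hb => hx b (by simp [hb])
    · simp [hS, hkl.symm, StackOp.exec, popX]
      funext j
      by_cases h1 : j = l
      · subst h1; simp
      · by_cases h2 : j = k
        · subst h2; simp [hkl]
        · simp [h1, h2]
    · simp; omega

/-- The stacks used only within a sweep are empty. -/
structure Store.Clean (s : Store) : Prop where
  t : s.t = []
  a' : s.a' = []
  v : s.v = []
  u : s.u = []
  z : s.z = []

/-- A sweep whose result is written on a given stack. -/
def sweepTo (g : Bool → ZMod 2 → ZMod 2 → ZMod 2 → ZMod 2)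
    (h : Bool → ZMod 2 → ZMod 2 → ZMod 2 → Option (ZMod 2)) (k : Stack) : Prog :=
  .seq (sweep g h) (.seq (move .z .t) (move .t k))

/-- The two moves through `t` preserve the order. The target may be `b` itself, because the sweep
has emptied it by then; hence `hk` is required only after `b` is erased. -/
theorem runs_sweepTo (g : Bool → ZMod 2 → ZMod 2 → ZMod 2 → ZMod 2)
    (h : Bool → ZMod 2 → ZMod 2 → ZMod 2 → Option (ZMod 2)) {w : ℕ} (a u : Fin w → ZMod 2)
    (vs : List (Fin w → ZMod 2)) (fl : Bool) (s : Store) (hs : s.Clean)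
    (ha : s.a = (List.ofFn a).map Symbol.bit) (hb : s.b = encVecs vs) (hu : Represents s.u' u)
    (k : Stack) (hk : { s with b := [] }.fn k = []) (hkt : .t ≠ k) (hkz : .z ≠ k) (hku : .u' ≠ k) :
    ∃ l, Represents l (vs.foldl (sweepStep g h a) (fl, u, [])).2.1 ∧
      Runs (sweepTo g h k) (reg 0 fl, s.fn)
        (reg 0 (vs.foldl (sweepStep g h a) (fl, u, [])).1,
          Function.update { s with b := [], u' := l }.fn k
            (enc (vs.foldl (sweepStep g h a) (fl, u, [])).2.2))
        (vs.length * (4 * w + 5) + 3 +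
          4 * (enc (vs.foldl (sweepStep g h a) (fl, u, [])).2.2).length) := by
  obtain ⟨l, hl, h1⟩ := runs_sweep g h a u vs [] fl s ha hb hu hs.a' hs.v hs.u hs.z
  refine ⟨l, hl, ?_⟩
  generalize vs.foldl (sweepStep g h a) (fl, u, []) = R at *
  refine runs_of_eq (.seq h1 (.seq (runs_move (by decide) 0 R.1 _ (enc R.2.2) rfl)
    (runs_move hkt 0 R.1 _ (enc R.2.2).reverse (by simp [hs.t])))) ?_ ?_
  · rw [Prod.mk.injEq]
    refine ⟨rfl, ?_⟩
    funext j
    have h1 := hs.t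
    have h2 := hs.z
    cases j <;> cases k <;> simp_all
  · simp only [List.length_reverse]
    omega

/-- Eliminate the current equation. -/
def elim : Prog := sweepTo elimG elimH .b

/-- The pivot left over from an earlier sweep is harmless, since the flag starts as false. -/
theorem runs_elim {w : ℕ} (a u : Fin w → ZMod 2) (vs : List (Fin w → ZMod 2)) (s : Store)
    (hs : s.Clean) (ha : s.a = (List.ofFn a).map Symbol.bit) (hb : s.b = encVecs vs)
    (hu : Represents s.u' u) :
    ∃ (vs' : List (Fin w → ZMod 2)) (l : List Symbol) (u' : Fin w → ZMod 2) (fl : Bool),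
      Represents l u' ∧
      Runs elim (reg 0 false, s.fn) (reg 0 fl, { s with b := encVecs vs', u' := l }.fn)
        (vs.length * (8 * w + 9) + 3) ∧
      vs'.length = vs.length ∧ (fl = true ↔ ∃ v ∈ vs, a ⬝ᵥ v ≠ 0) ∧
      ∀ x, x ∈ spanList vs' ↔ x ∈ spanList vs ∧ a ⬝ᵥ x = 0 := by
  obtain ⟨vs', h1, h2, h3, h4⟩ := elim_spec a u vs
  obtain ⟨l, hl, hrun⟩ := runs_sweepTo elimG elimH a u vs false s hs ha hb hu .b rfl
    (by decide) (by decide) (by decide)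
  refine ⟨vs', l, _, _, hl, runs_of_eq hrun ?_ ?_, h2, h3, h4⟩
  · rw [h1]
    simp [encVecs]
  · rw [h1, show enc (vs'.map List.ofFn) = encVecs vs' from rfl, length_encVecs, h2]
    ring_nf
    omega

theorem reverse_ofFn {α : Type} {w : ℕ} (f : Fin w → α) :
    (List.ofFn f).reverse = List.ofFn fun i => f i.rev := by
  refine List.ext_getElem (by simp) fun i h1 h2 => ?_
  simp only [List.getElem_reverse, List.getElem_ofFn, List.length_ofFn]
  congr 1
  ext
  simp only [Fin.val_rev]
  omega

/-- Eliminate all equations of a list. -/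
def ker : Prog :=
  .loop [popX .i] someX (.seq (.block [.load fun _ => reg 0 false])
    (.seq (take isBit .i .a) (.seq elim (clear .a))))

/-- Popping a row onto `a` turns it upside down, whence `i.rev`. The list of vectors never grows, so
all rounds have the same time bound. -/
theorem runs_ker {w : ℕ} (rows vs : List (Fin w → ZMod 2)) (u : Fin w → ZMod 2) (fl : Bool)
    (s : Store) (hs : s.Clean) (hi : s.i = encVecs rows) (ha : s.a = []) (hb : s.b = encVecs vs)
    (hu : Represents s.u' u) :
    ∃ (vs' : List (Fin w → ZMod 2)) (l : List Symbol) (u' : Fin w → ZMod 2) (fl' : Bool),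
      Represents l u' ∧
      Runs ker (reg 0 fl, s.fn) (reg 0 fl', { s with i := [], b := encVecs vs', u' := l }.fn)
        (rows.length * (vs.length * (8 * w + 9) + 4 * w + 8) + 1) ∧
      vs'.length = vs.length ∧
      ∀ x, x ∈ spanList vs' ↔ x ∈ spanList vs ∧ ∀ r ∈ rows, (fun i => r i.rev) ⬝ᵥ x = 0 := by
  induction rows generalizing s vs u fl with
  | nil =>
    refine ⟨vs, s.u', u, fl, hu, runs_of_eq (runs_loop_exit rfl ?_) ?_ (by simp), rfl, by simp⟩
    · simp [someX, hi, encVecs, enc]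
    · rcases s with ⟨⟩
      simp_all [reg, encVecs, enc]
  | cons r rows ih =>
    obtain ⟨vs₁, l₁, u₁, fl₁, hu₁, hrun₁, hlen₁, -, hsp₁⟩ := runs_elim (fun i => r i.rev) u vs
      { s with i := encVecs rows, a := (List.ofFn fun i => r i.rev).map Symbol.bit }
      ⟨hs.t, hs.a', hs.v, hs.u, hs.z⟩ rfl hb hu
    obtain ⟨vs', l', u', fl', hu', hrun, hlen, hsp⟩ := ih vs₁ u₁ fl₁
      { s with i := encVecs rows, b := encVecs vs₁, u' := l₁ }
      ⟨hs.t, hs.a', hs.v, hs.u, hs.z⟩ rfl ha rfl hu₁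
    refine ⟨vs', l', u', fl', hu', ?_, hlen.trans hlen₁, fun x => ?_⟩
    · have hpre : execs [popX .i] (reg 0 fl, s.fn) =
          (⟨some .eqn, none, none, 0, fl⟩, { s with i := s.i.tail }.fn) := by
        simp [hi, encVecs, enc, reg]
      refine runs_of_eq (runs_loop_step (t := 1 + (2 * w + 2 + ((vs.length * (8 * w + 9) + 3) +
        (2 * w + 1)))) hpre rfl ?_ hrun) rfl ?_
      · refine .seq (runs_block rfl) (.seq (runs_of_eq (runs_take (by decide) 0 false _
          ((List.ofFn r).map Symbol.bit) (encVecs rows) ?_ ?_ (isBit_head?_encVecs _)) ?_ (by simp))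
          (.seq hrun₁ (runs_of_eq (runs_clear .a 0 fl₁ _
            ((List.ofFn fun i => r i.rev).map Symbol.bit) rfl) ?_ (by simp))))
        · simp [hi, encVecs, enc]
        · simp [isBit]
        · simp [ha, reverse_ofFn, Function.comp_def]
        · simp [ha]
      · rw [hlen₁, List.length_cons]
        ring_nf
        omega
    · rw [hsp, hsp₁, List.forall_mem_cons, and_assoc]

theorem replicate_append_cons {α : Type} (j : ℕ) (a : α) (l : List α) :
    List.replicate j a ++ a :: l = a :: (List.replicate j a ++ l) := by
  induction j with
  | zero => rfl
  | succ j ih => simp [List.replicate_succ, ih]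

/-- Write as many zeros on the stack of vectors as another stack has symbols. -/
def zeros (k : Stack) : Prog :=
  .seq (.loop [popX k] someX (.block [pushX .t, pushS .b (.bit 0)])) (move .t k)

/-- The stack `k` is a unary counter, saved on `t` while it is read and then restored. -/
theorem runs_zeros {k : Stack} (hkt : k ≠ .t) (hkb : k ≠ .b) (acc : ZMod 2) (fl : Bool)
    (S : Stack → List Symbol) (j : ℕ) (hk : S k = List.replicate j .var) (ht : S .t = []) :
    Runs (zeros k) (reg acc fl, S)
      (reg acc fl, Function.update S .b (List.replicate j (.bit 0) ++ S .b)) (4 * j + 2) := by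
  have H : ∀ (j : ℕ) (S : Stack → List Symbol) o, S k = List.replicate j .var →
      Runs (.loop [popX k] someX (.block [pushX .t, pushS .b (.bit 0)]))
      (⟨o, none, none, acc, fl⟩, S)
      (reg acc fl, Function.update (Function.update (Function.update S k []) .t
        (List.replicate j .var ++ S .t)) .b (List.replicate j (.bit 0) ++ S .b))
      (2 * j + 1) := by
    intro j
    induction j with
    | zero =>
      intro S o hk
      refine runs_of_eq (runs_loop_exit rfl ?_) ?_ (by simp)
      · simp [someX, hk]
      · simp [hk, reg]
        funext x
        by_cases h1 : x = .t
        · subst h1; simp [hkt.symm]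
        · by_cases h2 : x = .b
          · subst h2; simp [hkb.symm]
          · by_cases h3 : x = k
            · subst h3; simp [h1, h2]
            · simp [h1, h2, h3]
    | succ j ih =>
      intro S o hk
      refine runs_of_eq (runs_loop_step rfl ?_ (runs_block rfl) (ih _ _ ?_)) ?_ ?_
      · simp [someX, hk, List.replicate_succ]
      · simp [hk, hkt, hkb, StackOp.exec, pushX, pushF]
      · simp [hk, hkt.symm, hkb.symm, StackOp.exec, pushX, pushF, List.replicate_succ]
        funext x
        by_cases h1 : x = .t
        · subst h1; simp [replicate_append_cons]
        · by_cases h2 : x = .b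
          · subst h2; simp [replicate_append_cons]
          · by_cases h3 : x = k
            · subst h3; simp [h1, h2]
            · simp [h1, h2, h3]
      · omega
  refine runs_of_eq (.seq (H j S none hk) (runs_move hkt.symm acc fl _ (List.replicate j .var) ?_))
    ?_ ?_
  · simp [ht]
  · simp
    funext x
    by_cases h1 : x = .b
    · subst h1; simp [hkb.symm]
    · by_cases h2 : x = .t
      · subst h2; simp [hkt.symm, ht]
      · by_cases h3 : x = k
        · subst h3; simp [h1, h2, hk]
        · simp [h1, h2, h3]
  · simp; omega

end MaxDifferAffineSAT

/-! ### Standard basis, counting, comparison, input and output -/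

namespace MaxDifferAffineSAT
open StackOp (execs)
open StackProg (Runs)

/-- The standard basis. -/
def stdVecs (w : ℕ) : List (Fin w → ZMod 2) := (List.finRange w).map fun i => Pi.single i 1

theorem length_stdVecs (w : ℕ) : (stdVecs w).length = w := by simp [stdVecs]

theorem mem_spanList_stdVecs {w : ℕ} (x : Fin w → ZMod 2) : x ∈ spanList (stdVecs w) := by
  rw [← Finset.univ_sum_single x]
  refine Submodule.sum_mem _ fun i _ => ?_
  have : Pi.single i (x i) = x i • (Pi.single i 1 : Fin w → ZMod 2) := by
    rw [← Pi.single_smul, smul_eq_mul, mul_one]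
  rw [this]
  exact Submodule.smul_mem _ _
    (subset_spanList (List.mem_map.2 ⟨i, List.mem_finRange i, rfl⟩))

theorem ofFn_single {w : ℕ} (i : Fin w) :
    List.ofFn (Pi.single i 1 : Fin w → ZMod 2) =
      List.replicate i 0 ++ 1 :: List.replicate (w - 1 - i) 0 := by
  refine List.ext_getElem ?_ fun j h1 h2 => ?_
  · simp only [List.length_ofFn, List.length_append, List.length_replicate, List.length_cons]
    omega
  rw [List.getElem_ofFn]
  rcases lt_trichotomy j i with h | h | h
  · rw [List.getElem_append_left (by simpa using h), List.getElem_replicate,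
      Pi.single_eq_of_ne (Fin.ne_of_val_ne h.ne)]
  · subst h
    simp
  · rw [List.getElem_append_right (by simpa using h.le),
      Pi.single_eq_of_ne (Fin.ne_of_val_ne h.ne')]
    obtain ⟨k, hk⟩ := Nat.exists_eq_add_of_lt h
    simp [show j - i = k + 1 by omega]

/-- Write the standard basis. -/
def ident : Prog :=
  .loop [popX .q] someX (.seq (.block [clr]) (.seq (zeros .p)
    (.seq (.block [pushS .b (Symbol.bit 1)]) (.seq (zeros .q)
      (.block [pushS .b Symbol.eqn, pushS .p Symbol.var])))))

theorem runs_ident (w : ℕ) (fl : Bool) (s : Store) (hq : s.q = List.replicate w Symbol.var)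
    (hp : s.p = []) (ht : s.t = []) (hb : s.b = []) :
    Runs ident (reg 0 fl, s.fn)
      (reg 0 fl, { s with q := [], p := List.replicate w Symbol.var, b := encVecs (stdVecs w) }.fn)
      (w * (4 * w + 8) + 1) := by
  -- The basis is written from its last vector upwards. With k rounds to go, the vectors of index at
  -- least k are on `b`; within a round, `p` counts the zeros after the 1 and `q` those before it.
  suffices H : ∀ k ≤ w, Runs ident
      (reg 0 fl, { s with
        q := List.replicate k Symbol.var
        p := List.replicate (w - k) Symbol.var
        b := encVecs (((List.finRange w).drop k).map fun i => Pi.single i 1) }.fn)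
      (reg 0 fl, { s with q := [], p := List.replicate w Symbol.var, b := encVecs (stdVecs w) }.fn)
      (k * (4 * w + 8) + 1) by
    have := H w le_rfl
    rw [List.drop_eq_nil_of_le (by simp)] at this
    rcases s with ⟨⟩
    simp only at hq hp hb
    subst hq hp hb
    simpa [encVecs, enc] using this
  intro k
  induction k with
  | zero =>
    intro _
    refine runs_of_eq (runs_loop_exit rfl ?_) ?_ (by simp)
    · simp [someX]
    · simp [reg, stdVecs]
  | succ k ih =>
    intro hk
    have hpre : execs [popX .q] (reg 0 fl, { s with
        q := List.replicate (k + 1) Symbol.var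
        p := List.replicate (w - (k + 1)) Symbol.var
        b := encVecs (((List.finRange w).drop (k + 1)).map fun i => Pi.single i 1) }.fn) =
        (⟨some Symbol.var, none, none, 0, fl⟩, { s with
        q := List.replicate k Symbol.var
        p := List.replicate (w - (k + 1)) Symbol.var
        b := encVecs (((List.finRange w).drop (k + 1)).map fun i => Pi.single i 1) }.fn) := by
      simp [reg, List.replicate_succ]
    refine runs_of_eq (runs_loop_step (t := 1 + ((4 * (w - (k + 1)) + 2) + (1 + ((4 * k + 2) + 1))))
      hpre rfl (.seq (runs_block rfl) (.seq (runs_zeros (by decide) (by decide) 0 fl _ _ rfl ht)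
      (.seq (runs_block rfl) (.seq (runs_of_eq (runs_zeros (by decide) (by decide) 0 fl _ k ?_ ?_)
      rfl le_rfl) (runs_block ?_))))) (ih (by omega))) rfl ?_
    · simp
    · simp [ht]
    · rw [List.drop_eq_getElem_cons (i := k) (by simpa using hk)]
      simp [encVecs, enc, ofFn_single, show w - k = w - (k + 1) + 1 by omega, List.replicate_succ,
        show w - 1 - k = w - (k + 1) by omega]
    · have h1 : k + (w - (k + 1)) + 1 = w := by omega
      rw [add_mul]
      omega

/-- Write the equation saying that the homogenizing coordinate vanishes. -/
def firstUnit : Prog :=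
  .seq (.loop [popX .p] someX (.block [pushS .a (Symbol.bit 0)]))
    (.block [popX .a, pushS .a (Symbol.bit 1), clr])

theorem runs_firstUnit (n : ℕ) (fl : Bool) (s : Store)
    (hp : s.p = List.replicate (n + 1) Symbol.var) (ha : s.a = []) :
    Runs firstUnit (reg 0 fl, s.fn)
      (reg 0 fl, { s with
        p := []
        a := (List.ofFn (Pi.single 0 1 : Fin (n + 1) → ZMod 2)).map Symbol.bit }.fn)
      (2 * n + 4) := by
  have H : ∀ (k : ℕ) (s : Store) o, s.p = List.replicate k Symbol.var →
      Runs (.loop [popX .p] someX (.block [pushS .a (Symbol.bit 0)])) (⟨o, none, none, 0, fl⟩, s.fn)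
      (reg 0 fl, { s with p := [], a := List.replicate k (Symbol.bit 0) ++ s.a }.fn)
      (2 * k + 1) := by
    intro k
    induction k with
    | zero =>
      intro s o hs
      refine runs_of_eq (runs_loop_exit rfl ?_) ?_ (by simp)
      · simp [someX, hs]
      · simp [reg, hs]
    | succ k ih =>
      intro s o hs
      refine runs_of_eq (runs_loop_step rfl ?_ (runs_block ?_)
        (ih { s with p := s.p.tail, a := Symbol.bit 0 :: s.a } (some Symbol.var) ?_)) ?_ ?_
      · simp [someX, hs, List.replicate_succ]
      · simp [hs, List.replicate_succ]
      · simp [hs]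
      · simp [replicate_append_cons, List.replicate_succ]
      · omega
  refine runs_of_eq (.seq (H _ s none hp) (runs_block rfl)) ?_ ?_
  · simp [ha, List.replicate_succ, reg, ofFn_single, -List.ofFn_succ]
  · omega

/-- Count the coordinates of the mask. -/
def count : Prog :=
  .loop [popX .u'] someX (.block [.push .q (fun r => decide (bitOf r.x ≠ 0)) (fun _ => Symbol.var),
    .push .c (fun r => decide (bitOf r.x ≠ 0)) (fun _ => Symbol.var)])

/-- Two copies of the count are needed: `c` is consumed by `compare`, while `q` gives the dimension
to the second run of `ident`. -/
theorem runs_count {w : ℕ} (u : Fin w → ZMod 2) (fl : Bool) (s : Store) (hu : Represents s.u' u)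
    (hq : s.q = []) (hc : s.c = []) :
    Runs count (reg 0 fl, s.fn)
      (reg 0 fl, { s with
        u' := []
        q := List.replicate (maskList u).length Symbol.var
        c := List.replicate (maskList u).length Symbol.var }.fn) (2 * w + 1) := by
  have H : ∀ (l : List (ZMod 2)) (s : Store) o, s.u' = l.map Symbol.bit →
      Runs count (⟨o, none, none, 0, fl⟩, s.fn) (reg 0 fl, { s with
        u' := []
        q := List.replicate (l.filter (· ≠ 0)).length Symbol.var ++ s.q
        c := List.replicate (l.filter (· ≠ 0)).length Symbol.var ++ s.c }.fn)
      (2 * l.length + 1) := by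
    intro l
    induction l with
    | nil =>
      intro s o hs
      refine runs_of_eq (runs_loop_exit rfl ?_) ?_ (by simp)
      · simp [someX, hs]
      · simp [reg, hs]
    | cons a l ih =>
      intro s o hs
      refine runs_of_eq (runs_loop_step rfl ?_ (runs_block ?_)
        (ih { s with
          u' := s.u'.tail
          q := if a ≠ 0 then .var :: s.q else s.q
          c := if a ≠ 0 then .var :: s.c else s.c } (some (Symbol.bit a)) ?_)) ?_ ?_
      · simp [someX, hs]
      · by_cases h0 : a = 0 <;> simp [hs, h0]
      · simp [hs]
      · by_cases h0 : a = 0 <;> simp [h0, replicate_append_cons, List.replicate_succ]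
      · simp; omega
  rcases hu with hu | ⟨hu, rfl⟩
  · refine runs_of_eq (H _ s none hu) ?_ (by simp)
    have : ((List.ofFn u).filter (· ≠ 0)).length = (maskList u).length := by
      rw [List.ofFn_eq_map, List.filter_map, List.length_map]
      rfl
    rw [this, hq, hc]
    simp
  · refine runs_of_eq (H [] s none hu) ?_ (by simp)
    simp [maskList, hq, hc]

/-- Compare the number of coordinates of the mask with twice the parameter. -/
def compare : Prog :=
  .seq (.block [.load fun _ => reg 0 false]) (.loop [popX .d] someX (.block [pushX .e, popY .c,
    popY .c, .load fun r => reg 0 (r.fl || r.y.isNone)]))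

/-- Each round removes one symbol from `d` and two from `c`; the second pop from `c` fails in some
round exactly when m < 2d. The copy on `e` is the parameter of the output. -/
theorem runs_compare (d m : ℕ) (fl : Bool) (s : Store) (hd : s.d = List.replicate d Symbol.param)
    (hc : s.c = List.replicate m Symbol.var) (he : s.e = []) :
    Runs compare (reg 0 fl, s.fn)
      (reg 0 (decide (m < 2 * d)), { s with
        d := []
        e := List.replicate d Symbol.param
        c := List.replicate (m - 2 * d) Symbol.var }.fn) (2 * d + 2) := by
  have H : ∀ (d m : ℕ) (s : Store) o fl, s.d = List.replicate d Symbol.param →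
      s.c = List.replicate m Symbol.var →
      Runs (.loop [popX .d] someX (.block [pushX .e, popY .c, popY .c,
        .load fun r => reg 0 (r.fl || r.y.isNone)])) (⟨o, none, none, 0, fl⟩, s.fn)
      (reg 0 (fl || decide (m < 2 * d)), { s with
        d := []
        e := List.replicate d Symbol.param ++ s.e
        c := List.replicate (m - 2 * d) Symbol.var }.fn) (2 * d + 1) := by
    intro d
    induction d with
    | zero =>
      intro m s o fl hd hc
      refine runs_of_eq (runs_loop_exit rfl ?_) ?_ (by simp)
      · simp [someX, hd]
      · simp [reg, hd, hc]
    | succ d ih =>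
      intro m s o fl hd hc
      have hr : (List.replicate m Symbol.var).tail.tail = List.replicate (m - 2) Symbol.var := by
        simp
        rfl
      have hh : (List.replicate m Symbol.var).tail.head?.isNone = decide (m < 2) := by
        rcases m with _ | _ | m <;> simp [List.replicate_succ]
      refine runs_of_eq (runs_loop_step rfl ?_ (runs_block ?_)
        (ih (m - 2) { s with d := s.d.tail, e := .param :: s.e, c := s.c.tail.tail } none
          (fl || decide (m < 2)) ?_ ?_)) ?_ ?_
      · simp [someX, hd, List.replicate_succ]
      · simp only [execs_popX, execs_pushX, execs_popY, execs_load, execs_nil, Store.fn_d,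
          Store.update_d, Store.fn_e, Store.update_e, Store.fn_c, Store.update_c]
        rw [hc, hh]
        simp [hd, reg, List.replicate_succ]
      · simp [hd]
      · rw [hc, hr]
      · simp only [replicate_append_cons, List.replicate_succ, List.cons_append]
        rw [show m - 2 - 2 * d = m - 2 * (d + 1) by omega, Bool.or_assoc, ← Bool.decide_or,
          decide_eq_decide.2 (show m < 2 ∨ m - 2 < 2 * d ↔ m < 2 * (d + 1) by omega)]
      · omega
  refine runs_of_eq (.seq (runs_block rfl) (H d m s none false hd hc)) ?_ (by omega)
  simp [he]

/-- The homogeneous equations with given coefficients (in reversed order). -/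
def eqnsOf {m : ℕ} (vs : List (Fin m → ZMod 2)) : List (AffineEquation m) :=
  vs.reverse.map fun y => ⟨fun i => y i.rev, 0⟩

/-- Write the output. -/
def output : Prog :=
  .seq (.loop [popX .b] someX (.seq (.block [pushS .o (Symbol.bit 0), clr])
    (.seq (take isBit .b .o) (.block [pushS .o Symbol.eqn])))) (.seq (move .p .o) (move .e .o))

/-- The output word is built from its end, which reverses both the list of equations and the
coefficients of each; `eqnsOf` records this. -/
theorem runs_output {m : ℕ} (d : ℕ) (vs : List (Fin m → ZMod 2)) (fl : Bool) (s : Store)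
    (hb : s.b = encVecs vs) (hp : s.p = List.replicate m Symbol.var)
    (he : s.e = List.replicate d Symbol.param) (ho : s.o = []) :
    Runs output (reg 0 fl, s.fn)
      (reg 0 fl, { s with
        b := []
        p := []
        e := []
        o := encode ⟨⟨m, eqnsOf vs⟩, d⟩ }.fn)
      (vs.length * (2 * m + 5) + 2 * m + 2 * d + 3) := by
  have H : ∀ (vs : List (Fin m → ZMod 2)) (s : Store), s.b = encVecs vs →
      Runs (.loop [popX .b] someX (.seq (.block [pushS .o (Symbol.bit 0), clr])
        (.seq (take isBit .b .o) (.block [pushS .o Symbol.eqn])))) (reg 0 fl, s.fn)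
      (reg 0 fl, { s with b := [], o := (eqnsOf vs).flatMap encodeEquation ++ s.o }.fn)
      (vs.length * (2 * m + 5) + 1) := by
    intro vs
    induction vs with
    | nil =>
      intro s hs
      refine runs_of_eq (runs_loop_exit rfl ?_) ?_ (by simp)
      · simp [someX, hs, encVecs, enc]
      · simp [reg, hs, encVecs, enc, eqnsOf]
    | cons v vs ih =>
      intro s hs
      have hpre : execs [popX .b] (reg 0 fl, s.fn) =
          (⟨some Symbol.eqn, none, none, 0, fl⟩, { s with b := s.b.tail }.fn) := by
        simp [hs, encVecs, enc, reg]
      refine runs_of_eq (runs_loop_step (t := 1 + (2 * m + 2 + 1)) hpre rfl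
        (.seq (runs_block rfl) (.seq (runs_of_eq (runs_take (by decide) 0 fl _
        ((List.ofFn v).map Symbol.bit) (encVecs vs) ?_ ?_ (isBit_head?_encVecs _)) rfl (by simp))
        (runs_block ?_))) (ih { s with
          b := encVecs vs
          o := encodeEquation ⟨fun i => v i.rev, 0⟩ ++ s.o } rfl)) ?_ ?_
      · simp [hs, encVecs, enc, StackOp.exec, pushS, pushF]
      · simp [isBit]
      · simp [StackOp.exec, pushS, pushF, encodeEquation, reverse_ofFn, Function.comp_def]
      · simp [eqnsOf]
      · rw [List.length_cons, add_mul]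
        omega
  refine runs_of_eq (.seq (H vs s hb) (.seq
    (runs_move (by decide) 0 fl _ (List.replicate m Symbol.var) (by simp [hp]))
    (runs_move (by decide) 0 fl _ (List.replicate d Symbol.param) (by simp [he])))) ?_ ?_
  · simp [ho, encode]
  · simp
    omega

/-- Read the parameter and the number of variables. -/
def parse : Prog :=
  .seq (take (fun o => decide (o = some Symbol.param)) .i .d)
    (.seq (take (fun o => decide (o = some Symbol.var)) .i .q) (.block [pushS .q Symbol.var]))

/-- The additional `var` on `q` makes room for the homogenizing coordinate. -/
theorem runs_parse (I : MaxDifferAffineSAT) (fl : Bool) (s : Store) (hi : s.i = encode I)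
    (hd : s.d = []) (hq : s.q = []) :
    Runs parse (reg 0 fl, s.fn)
      (reg 0 fl, { s with
        i := I.formula.equations.flatMap encodeEquation
        d := List.replicate I.d Symbol.param
        q := List.replicate (I.formula.numVars + 1) Symbol.var }.fn)
      (2 * I.d + 2 * I.formula.numVars + 5) := by
  have h1 : ∀ a, a ≠ Symbol.eqn → (I.formula.equations.flatMap encodeEquation).head? ≠ some a := by
    intro a ha
    cases I.formula.equations with
    | nil => simp
    | cons e l => simpa [encodeEquation] using ha.symm
  have h2 : ∀ (n : ℕ) (l : List Symbol), l.head? ≠ some .param →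
      (List.replicate n Symbol.var ++ l).head? ≠ some .param := by
    rintro (_ | n) l hl
    · simpa using hl
    · simp [List.replicate_succ]
  refine runs_of_eq (.seq (runs_take (by decide) 0 fl _ (List.replicate I.d Symbol.param)
    (List.replicate I.formula.numVars Symbol.var ++ I.formula.equations.flatMap encodeEquation)
    (by simp [hi, encode]) (by simp) ?_) (.seq (runs_take (by decide) 0 fl _
    (List.replicate I.formula.numVars Symbol.var) (I.formula.equations.flatMap encodeEquation)
    (by simp) (by simp) ?_) (runs_block rfl))) ?_ ?_
  · simpa using h2 _ _ (h1 Symbol.param (by decide))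
  · simpa using h1 Symbol.var (by decide)
  · simp [hd, hq, List.replicate_succ]
  · simp
    omega

/-- Empty several stacks and reset the registers. -/
def clearAll : List Stack → Prog
  | [] => .block [.load fun _ => reg 0 false]
  | k :: ks => .seq (clear k) (clearAll ks)

theorem runs_clearAll (ks : List Stack) (acc : ZMod 2) (fl : Bool) (S : Stack → List Symbol) (N : ℕ)
    (hS : ∀ k, (S k).length ≤ N) :
    Runs (clearAll ks) (reg acc fl, S) (reg 0 false, fun k => if k ∈ ks then [] else S k)
      (ks.length * (2 * N + 1) + 1) := by
  induction ks generalizing S with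
  | nil => exact runs_of_eq (runs_block rfl) (by simp) (by simp)
  | cons k ks ih =>
    refine runs_of_eq (.seq (runs_clear k acc fl S _ rfl) (ih (Function.update S k []) ?_)) ?_ ?_
    · intro j
      by_cases h : j = k
      · subst h; simp
      · simpa [h] using hS j
    · simp
      funext j
      by_cases h : j = k
      · subst h; simp
      · simp [h]
    · have := hS k
      rw [List.length_cons, add_mul]
      omega

end MaxDifferAffineSAT

namespace MaxDifferAffineSAT

/-! ### Correctness of the reduction -/

/-- The coefficients of an equation, followed by its right-hand side. -/
def homogenize {n : ℕ} (e : AffineEquation n) : Fin (n + 1) → ZMod 2 :=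
  Fin.snoc (α := fun _ => ZMod 2) e.coeff e.rhs

/-- The encoding puts the right-hand side last, so the input is already a list of rows of length n +
1 and needs no rewriting. -/
theorem flatMap_encodeEquation {n : ℕ} (l : List (AffineEquation n)) :
    l.flatMap encodeEquation = encVecs (l.map homogenize) := by
  simp only [encVecs, enc, List.flatMap_map]
  refine congrArg (fun f => List.flatMap f l) (funext fun e => ?_)
  simp [encodeEquation, homogenize, List.ofFn_succ', Function.comp_def, -List.ofFn_succ,
    List.concat_eq_append]

theorem dotProduct_rev {n : ℕ} (a b : Fin n → ZMod 2) :
    (fun i : Fin n => a i.rev) ⬝ᵥ (fun i => b i.rev) = a ⬝ᵥ b :=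
  Equiv.sum_comp Fin.revPerm fun i => a i * b i

theorem dotProduct_rev' {n : ℕ} (a b : Fin n → ZMod 2) :
    (fun i : Fin n => a i.rev) ⬝ᵥ b = a ⬝ᵥ (fun i => b i.rev) := by
  rw [← dotProduct_rev a]
  simp

/-- An assignment in reversed order, preceded by a constant. -/
def consRev {n : ℕ} (c : ZMod 2) (σ : Fin n → ZMod 2) : Fin (n + 1) → ZMod 2 :=
  Fin.cons (α := fun _ => ZMod 2) c fun i => σ i.rev

theorem eq_consRev {n : ℕ} (x : Fin (n + 1) → ZMod 2) :
    x = consRev (x 0) fun i => x i.rev.succ := by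
  funext i
  refine Fin.cases ?_ (fun i => ?_) i <;> simp [consRev]

/-- Reversal brings the right-hand side to coordinate 0, where it meets the constant c. For c = 1
the product vanishes iff the equation holds; for c = 0 only the homogeneous part remains. -/
theorem homogenize_dotProduct {n : ℕ} (e : AffineEquation n) (c : ZMod 2) (σ : Fin n → ZMod 2) :
    (fun i => homogenize e i.rev) ⬝ᵥ consRev c σ = e.rhs * c + e.coeff ⬝ᵥ σ := by
  rw [← dotProduct_rev e.coeff]
  simp [dotProduct, Fin.sum_univ_succ, homogenize, consRev, Fin.rev_succ]

theorem hammingNorm_consRev {n : ℕ} (σ : Fin n → ZMod 2) :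
    hammingNorm (consRev 0 σ) = hammingNorm σ := by
  simp only [hammingNorm, Finset.card_filter, Fin.sum_univ_succ]
  rw [← Equiv.sum_comp Fin.revPerm fun i => if σ i ≠ 0 then 1 else 0]
  simp [consRev]

theorem add_eq_zero_iff_zmod_two (x y : ZMod 2) : x + y = 0 ↔ y = x := by
  revert x y; decide

theorem satisfies_iff_consRev (φ : AffineFormula) (σ : Fin φ.numVars → ZMod 2) :
    φ.Satisfies σ ↔
      ∀ r ∈ φ.equations.map homogenize, (fun i => r i.rev) ⬝ᵥ consRev 1 σ = 0 := by
  simp only [List.forall_mem_map, homogenize_dotProduct, mul_one, add_eq_zero_iff_zmod_two]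
  rfl

theorem hammingDist_eq {n : ℕ} (σ τ : Fin n → ZMod 2) :
    hammingDist σ τ = hammingNorm (σ - τ) := by
  simp [hammingDist, hammingNorm, sub_ne_zero]

/-- Two solutions with leading coordinate 1 differ by one with leading coordinate 0; conversely, any
such difference can be subtracted from a fixed satisfying assignment. -/
theorem isYes_iff (I : MaxDifferAffineSAT) (vs : List (Fin (I.formula.numVars + 1) → ZMod 2))
    (hvs : ∀ x, x ∈ spanList vs ↔ x 0 = 0 ∧
      ∀ r ∈ I.formula.equations.map homogenize, (fun i => r i.rev) ⬝ᵥ x = 0) :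
    I.IsYes ↔ (∃ σ, I.formula.Satisfies σ) ∧ ∃ x ∈ spanList vs, I.d ≤ hammingNorm x := by
  have key : ∀ σ τ : Fin I.formula.numVars → ZMod 2, consRev 1 σ - consRev 1 τ =
      consRev 0 (σ - τ) := fun σ τ => by
    funext i
    refine Fin.cases ?_ (fun i => ?_) i <;> simp [consRev]
  constructor
  · rintro ⟨σ, τ, hσ, hτ, hd⟩
    refine ⟨⟨σ, hσ⟩, consRev 0 (σ - τ), (hvs _).2 ⟨rfl, fun r hr => ?_⟩, ?_⟩
    · rw [← key, dotProduct_sub, (satisfies_iff_consRev _ _).1 hσ r hr,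
        (satisfies_iff_consRev _ _).1 hτ r hr, sub_zero]
    · rwa [hammingNorm_consRev, ← hammingDist_eq]
  · rintro ⟨⟨σ, hσ⟩, x, hx, hd⟩
    obtain ⟨h0, hx⟩ := (hvs x).1 hx
    have hx' := eq_consRev x
    rw [h0] at hx'
    set δ : Fin I.formula.numVars → ZMod 2 := fun i => x i.rev.succ
    refine ⟨σ, σ - δ, hσ, (satisfies_iff_consRev _ _).2 fun r hr => ?_, ?_⟩
    · have : consRev 1 (σ - δ) = consRev 1 σ - x := by
        rw [hx', ← sub_sub_cancel σ δ, ← key, sub_sub_cancel]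
        simp
      rw [this, dotProduct_sub, (satisfies_iff_consRev _ _).1 hσ r hr, hx r hr, sub_zero]
    · rw [hammingDist_eq, sub_sub_cancel, ← hammingNorm_consRev, ← hx']
      exact hd

/-- If coordinate 0 vanished on all generators it would vanish on the span, which contains `consRev
1 σ` for every satisfying σ. A generator where it is 1 is itself a satisfying assignment. -/
theorem exists_satisfies_iff (φ : AffineFormula) (vs : List (Fin (φ.numVars + 1) → ZMod 2))
    (hvs : ∀ x, x ∈ spanList vs ↔
      ∀ r ∈ φ.equations.map homogenize, (fun i => r i.rev) ⬝ᵥ x = 0) :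
    (∃ σ, φ.Satisfies σ) ↔ ∃ v ∈ vs, (Pi.single 0 1 : Fin (φ.numVars + 1) → ZMod 2) ⬝ᵥ v ≠ 0 := by
  simp only [single_one_dotProduct]
  constructor
  · rintro ⟨σ, hσ⟩
    by_contra! hcon
    have := spanList_induction_zero (LinearMap.proj 0) hcon
      ((hvs _).2 ((satisfies_iff_consRev _ _).1 hσ))
    simp [consRev] at this
  · rintro ⟨v, hv, h0⟩
    refine ⟨fun i => v i.rev.succ, (satisfies_iff_consRev _ _).2 ?_⟩
    rw [← zmod_two_eq_one h0, ← eq_consRev]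
    exact (hvs _).1 (subset_spanList hv)

theorem not_isYes_one : ¬ IsYes ⟨⟨0, []⟩, 1⟩ := by
  rintro ⟨σ, τ, -, -, h⟩
  rw [Subsingleton.elim σ τ, hammingDist_self] at h
  exact absurd h (by simp)

theorem isYes_zero : IsYes ⟨⟨0, []⟩, 0⟩ :=
  ⟨0, 0, by simp [AffineFormula.Satisfies], by simp [AffineFormula.Satisfies], Nat.zero_le _⟩

/-- Restriction to the coordinates of a mask. -/
def restrict {w : ℕ} (u : Fin w → ZMod 2) :
    (Fin w → ZMod 2) →ₗ[ZMod 2] (Fin (maskList u).length → ZMod 2) :=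
  LinearMap.funLeft (ZMod 2) (ZMod 2) (maskList u).get

theorem mem_maskList {w : ℕ} (u : Fin w → ZMod 2) (i : Fin w) : i ∈ maskList u ↔ u i ≠ 0 := by
  simp [maskList]

theorem nodup_maskList {w : ℕ} (u : Fin w → ZMod 2) : (maskList u).Nodup :=
  (List.nodup_finRange w).filter _

theorem length_maskList {w : ℕ} (u : Fin w → ZMod 2) :
    (maskList u).length = (Finset.univ.filter (u · ≠ 0)).card := by
  rw [← List.toFinset_card_of_nodup (nodup_maskList u)]
  congr 1
  ext i
  simp [mem_maskList]

theorem hammingNorm_restrict {w : ℕ} (u x : Fin w → ZMod 2) (h : ∀ i, x i ≠ 0 → u i ≠ 0) :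
    hammingNorm (restrict u x) = hammingNorm x := by
  classical
  rw [hammingNorm, hammingNorm, ← Finset.card_image_of_injective _ (nodup_maskList u).injective_get]
  congr 1
  ext i
  simp only [Finset.mem_image, Finset.mem_filter, Finset.mem_univ, true_and]
  constructor
  · rintro ⟨j, hj, rfl⟩
    exact hj
  · intro hi
    obtain ⟨j, rfl⟩ := List.mem_iff_get.1 ((mem_maskList u i).2 (h i hi))
    exact ⟨j, hi, rfl⟩

/-- The list `ys` spans the reversed orthogonal complement of the rows, and `eqnsOf` reverses again,
so σ satisfies the equations iff it lies in the double complement. -/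
theorem satisfies_eqnsOf_iff {m : ℕ} (rows ys : List (Fin m → ZMod 2))
    (hys : ∀ y, y ∈ spanList ys ↔ ∀ r ∈ rows, (fun i => r i.rev) ⬝ᵥ y = 0) (σ : Fin m → ZMod 2) :
    AffineFormula.Satisfies ⟨m, eqnsOf ys⟩ σ ↔ σ ∈ spanList rows := by
  have h1 : AffineFormula.Satisfies ⟨m, eqnsOf ys⟩ σ ↔
      ∀ y ∈ ys, (fun i : Fin m => y i.rev) ⬝ᵥ σ = 0 := by
    simp only [AffineFormula.Satisfies, eqnsOf, List.forall_mem_map, List.mem_reverse]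
    rfl
  rw [h1, mem_of_dotProduct]
  constructor
  · intro h z hz
    have h2 : (fun i : Fin m => z i.rev) ∈ spanList ys := (hys _).2 fun r hr => by
      rw [dotProduct_rev]
      exact hz r (subset_spanList hr)
    have h3 := dotProduct_eq_zero_of_spanList (fun i : Fin m => σ i.rev)
      (fun y hy => by rw [dotProduct_rev', dotProduct_comm]; exact h y hy) h2
    rwa [dotProduct_rev, dotProduct_comm] at h3
  · intro h y hy
    refine h _ fun v hv => ?_
    rw [dotProduct_comm]
    refine dotProduct_eq_zero_of_spanList _ (fun r hr => ?_) hv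
    rw [dotProduct_comm, ← dotProduct_rev']
    exact (hys y).1 (subset_spanList hy) r hr

/-- The satisfying assignments are the restrictions of the span, a subspace, so their differences
are again such restrictions, and each one is its own difference from 0. Weights agree because the
span vanishes outside the mask. -/
theorem isYes_eqnsOf_iff {w d : ℕ} (u : Fin w → ZMod 2) (vs : List (Fin w → ZMod 2))
    (hu : ∀ i, u i ≠ 0 ↔ ∃ v ∈ vs, v i ≠ 0) (ys : List (Fin (maskList u).length → ZMod 2))
    (hys : ∀ y, y ∈ spanList ys ↔ ∀ r ∈ vs.map (restrict u), (fun i => r i.rev) ⬝ᵥ y = 0) :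
    IsYes ⟨⟨_, eqnsOf ys⟩, d⟩ ↔ ∃ x ∈ spanList vs, d ≤ hammingNorm x := by
  have hspan : spanList (vs.map (restrict u)) = (spanList vs).map (restrict u) := by
    rw [spanList, spanList, Submodule.map_span]
    congr 1
    ext x
    simp
  have hsat := satisfies_eqnsOf_iff _ ys hys
  have hnorm : ∀ x ∈ spanList vs, hammingNorm (restrict u x) = hammingNorm x := fun x hx =>
    hammingNorm_restrict u x fun i hi => (hu i).2 <| by
      by_contra! hcon
      exact hi (spanList_induction_zero (LinearMap.proj i) hcon hx)
  rw [hspan] at hsat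
  constructor
  · rintro ⟨σ, τ, hσ, hτ, hd⟩
    obtain ⟨x, hx, hxe⟩ := Submodule.mem_map.1 (sub_mem ((hsat σ).1 hσ) ((hsat τ).1 hτ))
    refine ⟨x, hx, ?_⟩
    rwa [← hnorm x hx, hxe, ← hammingDist_eq]
  · rintro ⟨x, hx, hd⟩
    refine ⟨restrict u x, 0, (hsat _).2 (Submodule.mem_map_of_mem hx), (hsat _).2 (zero_mem _), ?_⟩
    rw [hammingDist_zero_right, hnorm x hx]
    exact hd

theorem exists_of_le_length_maskList {w d : ℕ} (u : Fin w → ZMod 2) (vs : List (Fin w → ZMod 2))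
    (hu : ∀ i, u i ≠ 0 ↔ ∃ v ∈ vs, v i ≠ 0) (h : 2 * d ≤ (maskList u).length) :
    ∃ x ∈ spanList vs, d ≤ hammingNorm x := by
  obtain ⟨x, hx, hle⟩ := exists_le_hammingNorm (spanList vs) (Finset.univ.filter (u · ≠ 0))
    fun i hi => by
      obtain ⟨v, hv, hvi⟩ := (hu i).1 (Finset.mem_filter.1 hi).2
      exact ⟨v, subset_spanList hv, hvi⟩
  rw [← length_maskList] at hle
  exact ⟨x, hx, by omega⟩

end MaxDifferAffineSAT

namespace MaxDifferAffineSAT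
open StackOp (execs)
open StackProg (Runs)

/-! ### The program -/

/-- All stacks are empty. -/
def Store.nil : Store := ⟨[], [], [], [], [], [], [], [], [], [], [], [], [], [], []⟩

theorem Represents.length_le {w : ℕ} {l : List Symbol} {u : Fin w → ZMod 2}
    (h : Represents l u) : l.length ≤ w := by
  rcases h with rfl | ⟨rfl, -⟩ <;> simp

theorem length_maskList_le {w : ℕ} (u : Fin w → ZMod 2) : (maskList u).length ≤ w := by
  exact (List.length_filter_le _ _).trans_eq List.length_finRange

/-- Compute the differences of satisfying assignments; the flag tells whether the formula is
satisfiable. -/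
def solve : Prog :=
  .seq parse (.seq ident (.seq ker (.seq firstUnit
    (.seq (.block [.load fun _ => reg 0 false]) elim))))

/-- The last elimination imposes that coordinate 0 vanishes. Its flag is raised iff some generator
is nonzero there, which is satisfiability. -/
theorem runs_solve (I : MaxDifferAffineSAT) :
    ∃ (vs : List (Fin (I.formula.numVars + 1) → ZMod 2)) (l : List Symbol)
      (u : Fin (I.formula.numVars + 1) → ZMod 2) (fl : Bool), Represents l u ∧
      Runs solve (reg 0 false, { Store.nil with i := encode I }.fn) (reg 0 fl,
        { Store.nil with
          d := List.replicate I.d .param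
          a := (List.ofFn (Pi.single 0 1 : Fin (I.formula.numVars + 1) → ZMod 2)).map Symbol.bit
          b := encVecs vs
          u' := l }.fn)
        (2 * I.d + 2 * I.formula.numVars + 5 +
          ((I.formula.numVars + 1) * (4 * (I.formula.numVars + 1) + 8) + 1 +
          (I.formula.equations.length * ((I.formula.numVars + 1) *
            (8 * (I.formula.numVars + 1) + 9) + 4 * (I.formula.numVars + 1) + 8) + 1 +
          (2 * I.formula.numVars + 4 + (1 +
          ((I.formula.numVars + 1) * (8 * (I.formula.numVars + 1) + 9) + 3)))))) ∧
      vs.length = I.formula.numVars + 1 ∧ (fl = true ↔ ∃ σ, I.formula.Satisfies σ) ∧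
      ∀ x, x ∈ spanList vs ↔ x 0 = 0 ∧
        ∀ r ∈ I.formula.equations.map homogenize, (fun i => r i.rev) ⬝ᵥ x = 0 := by
  set n := I.formula.numVars
  set rows := I.formula.equations.map homogenize
  have hstd := length_stdVecs (n + 1)
  obtain ⟨vs₁, l₁, u₁, fl₁, hu₁, hrun₁, hlen₁, hsp₁⟩ := runs_ker rows (stdVecs (n + 1)) 0 false
    { Store.nil with
      i := encVecs rows
      d := List.replicate I.d .param
      p := List.replicate (n + 1) .var
      b := encVecs (stdVecs (n + 1)) } ⟨rfl, rfl, rfl, rfl, rfl⟩ rfl rfl rfl (Or.inr ⟨rfl, rfl⟩)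
  obtain ⟨vs, l, u, fl, hu, hrun, hlen, hfl, hsp⟩ := runs_elim (Pi.single 0 1) u₁ vs₁
    { Store.nil with
      d := List.replicate I.d .param
      a := (List.ofFn (Pi.single 0 1 : Fin (n + 1) → ZMod 2)).map Symbol.bit
      b := encVecs vs₁
      u' := l₁ } ⟨rfl, rfl, rfl, rfl, rfl⟩ rfl rfl hu₁
  have hsp₁' : ∀ x, x ∈ spanList vs₁ ↔ ∀ r ∈ rows, (fun i => r i.rev) ⬝ᵥ x = 0 := fun x => by
    rw [hsp₁]
    exact and_iff_right (mem_spanList_stdVecs x)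
  refine ⟨vs, l, u, fl, hu, ?_, by omega, ?_, fun x => ?_⟩
  · rw [hstd] at hrun₁
    rw [hlen₁, hstd] at hrun
    have h₁ : Runs parse (reg 0 false, { Store.nil with i := encode I }.fn) (reg 0 false,
        { Store.nil with
          i := encVecs rows
          d := List.replicate I.d .param
          q := List.replicate (n + 1) .var }.fn) _ :=
      runs_of_eq (runs_parse I false _ rfl rfl rfl) (by simp [rows, n, flatMap_encodeEquation])
        le_rfl
    have h₂ := runs_ident (n + 1) false
      { Store.nil with
        i := encVecs rows
        d := List.replicate I.d .param
        q := List.replicate (n + 1) .var } rfl rfl rfl rfl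
    have h₃ := runs_firstUnit n fl₁
      { Store.nil with
        d := List.replicate I.d .param
        p := List.replicate (n + 1) .var
        b := encVecs vs₁
        u' := l₁ } rfl rfl
    have hlen' : rows.length = I.formula.equations.length := List.length_map _
    rw [hlen'] at hrun₁
    exact .seq h₁ (.seq h₂ (.seq hrun₁ (.seq h₃ (.seq (runs_block rfl) hrun))))
  · rw [hfl, exists_satisfies_iff I.formula vs₁ hsp₁']
  · rw [hsp, hsp₁', single_one_dotProduct, and_comm]

/-- Restrict the differences to the coordinates that are not constant, and compare their number
with twice the parameter. -/
def reduce : Prog :=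
  .seq (clear .u') (.seq (sweepTo maskG maskH .b) (.seq (sweepTo restrG restrH .i)
    (.seq (clear .a) (.seq count compare))))

/-- Emptying `u'` makes the mask start from zero, and `a` only drives the two sweeps. Their
reversals of the list cancel. -/
theorem runs_reduce {w : ℕ} (d : ℕ) (a u : Fin w → ZMod 2) (vs : List (Fin w → ZMod 2))
    (l : List Symbol) (hl : Represents l u) (fl : Bool) :
    ∃ u : Fin w → ZMod 2, (∀ i, u i ≠ 0 ↔ ∃ v ∈ vs, v i ≠ 0) ∧
      Runs reduce (reg 0 fl,
        { Store.nil with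
          d := List.replicate d .param
          a := (List.ofFn a).map Symbol.bit
          b := encVecs vs
          u' := l }.fn) (reg 0 (decide ((maskList u).length < 2 * d)),
        { Store.nil with
          i := encVecs (vs.map (restrict u))
          e := List.replicate d .param
          q := List.replicate (maskList u).length .var
          c := List.replicate ((maskList u).length - 2 * d) .var }.fn)
        (vs.length * (16 * w + 18) + 6 * w + 2 * d + 11) := by
  obtain ⟨l₁, hl₁, h₁⟩ := runs_sweepTo maskG maskH a 0 vs fl
    { Store.nil with
      d := List.replicate d .param
      a := (List.ofFn a).map Symbol.bit
      b := encVecs vs } ⟨rfl, rfl, rfl, rfl, rfl⟩ rfl rfl (Or.inr ⟨rfl, rfl⟩) .b rfl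
    (by decide) (by decide) (by decide)
  obtain ⟨hm, hu⟩ := mask_spec a vs (fl, 0, [])
  generalize vs.foldl (sweepStep maskG maskH a) (fl, 0, []) = R at *
  obtain ⟨fl₁, u, out⟩ := R
  dsimp only at *
  subst hm
  obtain ⟨l₂, hl₂, h₂⟩ := runs_sweepTo restrG restrH a u vs.reverse fl₁
    { Store.nil with
      d := List.replicate d .param
      a := (List.ofFn a).map Symbol.bit
      b := encVecs vs.reverse
      u' := l₁ } ⟨rfl, rfl, rfl, rfl, rfl⟩ rfl rfl hl₁ .i rfl
    (by decide) (by decide) (by decide)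
  obtain ⟨hr, hr'⟩ := restr_spec a vs.reverse (fl₁, u, [])
  generalize vs.reverse.foldl (sweepStep restrG restrH a) (fl₁, u, []) = R at *
  obtain ⟨fl₂, u₂, out⟩ := R
  dsimp only at *
  subst hr hr'
  have henc : enc (vs.reverse.reverse.map (fun v => List.ofFn fun j => v ((maskList u₂).get j)) ++
      []) = encVecs (vs.map (restrict u₂)) := by
    rw [encVecs, List.reverse_reverse, List.append_nil, List.map_map]
    rfl
  have henc' : enc (vs.reverse.map List.ofFn ++ []) = encVecs vs.reverse := by
    rw [List.append_nil]
    rfl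
  rw [henc, length_encVecs] at h₂
  rw [henc', length_encVecs] at h₁
  refine ⟨u₂, by simpa using hu, ?_⟩
  have hle := length_maskList_le u₂
  have h₀ := runs_clear .u' 0 fl
    { Store.nil with
      d := List.replicate d .param
      a := (List.ofFn a).map Symbol.bit
      b := encVecs vs
      u' := l }.fn l rfl
  rw [Store.update_u'] at h₀
  rw [Store.update_b] at h₁
  rw [Store.update_i] at h₂
  have h₃ := runs_clear .a 0 fl₂
    { Store.nil with
      i := encVecs (vs.map (restrict u₂))
      d := List.replicate d .param
      a := (List.ofFn a).map Symbol.bit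
      u' := l₂ }.fn _ rfl
  rw [Store.update_a] at h₃
  have h₄ := runs_count u₂ fl₂
    { Store.nil with
      i := encVecs (vs.map (restrict u₂))
      d := List.replicate d .param
      u' := l₂ } hl₂ rfl rfl
  have h₅ := runs_compare d (maskList u₂).length fl₂
    { Store.nil with
      i := encVecs (vs.map (restrict u₂))
      d := List.replicate d .param
      q := List.replicate (maskList u₂).length .var
      c := List.replicate (maskList u₂).length .var } rfl rfl rfl
  refine runs_of_eq (.seq h₀ (.seq h₁ (.seq h₂ (.seq h₃ (.seq h₄ h₅))))) rfl ?_
  have hw := hl.length_le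
  have hm := Nat.mul_le_mul_left vs.length (Nat.add_le_add_right hle 1)
  simp only [List.length_map, List.length_reverse, Store.fn_a, List.length_ofFn] at *
  nlinarith

/-- Compute and write the equations of the kernel. -/
def finish : Prog := .seq ident (.seq ker output)

/-- Here the restricted vectors play the role of equations, so the result spans their orthogonal
complement up to reversal. Starting from m basis vectors, elimination yields exactly m equations. -/
theorem runs_finish {m : ℕ} (d : ℕ) (rows : List (Fin m → ZMod 2)) (x : List Symbol) (fl : Bool) :
    ∃ (ys : List (Fin m → ZMod 2)) (l : List Symbol) (u : Fin m → ZMod 2) (fl' : Bool),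
      Represents l u ∧
      Runs finish (reg 0 fl,
        { Store.nil with
          i := encVecs rows
          e := List.replicate d .param
          q := List.replicate m .var
          c := x }.fn) (reg 0 fl',
        { Store.nil with
          o := encode ⟨⟨m, eqnsOf ys⟩, d⟩
          c := x
          u' := l }.fn)
        (m * (4 * m + 8) + 1 + (rows.length * (m * (8 * m + 9) + 4 * m + 8) + 1 +
          (m * (2 * m + 5) + 2 * m + 2 * d + 3))) ∧
      ys.length = m ∧ ∀ y, y ∈ spanList ys ↔ ∀ r ∈ rows, (fun i => r i.rev) ⬝ᵥ y = 0 := by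
  obtain ⟨ys, l, u, fl', hu, hrun, hlen, hsp⟩ := runs_ker rows (stdVecs m) 0 fl
    { Store.nil with
      i := encVecs rows
      e := List.replicate d .param
      p := List.replicate m .var
      b := encVecs (stdVecs m)
      c := x } ⟨rfl, rfl, rfl, rfl, rfl⟩ rfl rfl rfl (Or.inr ⟨rfl, rfl⟩)
  rw [length_stdVecs] at hlen hrun
  have hout := runs_output d ys fl' { Store.nil with
      e := List.replicate d .param
      p := List.replicate m .var
      b := encVecs ys
      u' := l
      c := x } rfl rfl rfl rfl
  rw [hlen] at hout
  refine ⟨ys, l, u, fl', hu, .seq (runs_of_eq (runs_ident m fl _ rfl rfl rfl rfl) rfl le_rfl)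
    (.seq (runs_of_eq hrun rfl le_rfl) hout), hlen, fun y => ?_⟩
  rw [hsp]
  exact and_iff_right (mem_spanList_stdVecs y)

/-- All stacks but the output. -/
def workStacks : List Stack := [.i, .d, .e, .p, .q, .t, .a, .a', .b, .v, .u, .u', .z, .c]

theorem runs_clearAll_workStacks (fl : Bool) (s : Store) (N : ℕ) (h : ∀ k, (s.fn k).length ≤ N) :
    Runs (clearAll workStacks) (reg 0 fl, s.fn) (reg 0 false, { Store.nil with o := s.o }.fn)
      (28 * N + 15) := by
  refine runs_of_eq (runs_clearAll workStacks 0 fl s.fn N h) ?_ (by simp [workStacks]; omega)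
  refine congrArg _ (funext fun k => ?_)
  cases k <;> rfl

/-- The kernelization. -/
def main : Prog :=
  .seq solve (.seq (.ite (·.fl) (.seq reduce (.ite (·.fl) finish (.block [])))
    (.block [pushS .o .param])) (clearAll workStacks))

/-- The three phases cost at most 80, 60 and 80 times the cube, and clearing the stacks costs about
28 · 5 times the square; 500 leaves room for the rest. -/
theorem exists_runs_main (I : MaxDifferAffineSAT) : ∃ J : MaxDifferAffineSAT,
    Runs main (reg 0 false, { Store.nil with i := encode I }.fn)
      (reg 0 false, { Store.nil with o := encode J }.fn) (500 * (I.encode.length + 2) ^ 3) ∧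
    (J.IsYes ↔ I.IsYes) ∧ J.formula.numVars ≤ 2 * I.d ∧
    J.formula.equations.length ≤ 2 * I.d ∧ J.d ≤ I.d + 1 := by
  obtain ⟨vs, l, u₀, fl, hl, hsolve, hlen, hfl, hsp⟩ := runs_solve I
  have hyes := isYes_iff I vs hsp
  -- W bounds d, the dimension n + 1 and the number of equations; the 2 makes it large enough to
  -- absorb additive constants.
  obtain ⟨W, hW⟩ : ∃ W, W = I.encode.length + 2 := ⟨_, rfl⟩
  have hL := length_encode I
  rw [← hW]
  have hd : I.d ≤ W := by omega
  have hn : I.formula.numVars + 1 ≤ W := by omega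
  have hR : I.formula.equations.length ≤ W := by
    have := Nat.le_mul_of_pos_right I.formula.equations.length
      (show 0 < I.formula.numVars + 2 by omega)
    omega
  have hlW := hl.length_le
  have h1 : W ≤ W ^ 2 := Nat.le_self_pow (by omega) W
  have h2 : W ^ 2 ≤ W ^ 3 := Nat.pow_le_pow_right (by omega) (by omega)
  -- The bound 5 W² serves for every stack at the final clearing; it is dictated by the output, of
  -- length d + m + m (m + 2) ≤ W² + 4 W.
  have hb : (encVecs vs).length ≤ 5 * W ^ 2 := by
    rw [length_encVecs, hlen]
    nlinarith
  have hts : 2 * I.d + 2 * I.formula.numVars + 5 +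
      ((I.formula.numVars + 1) * (4 * (I.formula.numVars + 1) + 8) + 1 +
      (I.formula.equations.length * ((I.formula.numVars + 1) *
        (8 * (I.formula.numVars + 1) + 9) + 4 * (I.formula.numVars + 1) + 8) + 1 +
      (2 * I.formula.numVars + 4 + (1 +
      ((I.formula.numVars + 1) * (8 * (I.formula.numVars + 1) + 9) + 3))))) ≤ 80 * W ^ 3 := by
    calc _ ≤ 2 * W + 2 * W + 5 + (W * (4 * W + 8) + 1 + (W * (W * (8 * W + 9) + 4 * W + 8) + 1 +
          (2 * W + 4 + (1 + (W * (8 * W + 9) + 3))))) := by gcongr <;> omega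
      _ = 8 * W ^ 3 + 25 * W ^ 2 + 31 * W + 15 := by ring
      _ ≤ _ := by omega
  cases fl with
  | false =>
    have hstore : ∀ s : Store, s.o = [] → Runs (.block [pushS .o .param]) (reg 0 false, s.fn)
        (reg 0 false, { s with o := encode ⟨⟨0, []⟩, 1⟩ }.fn) 1 := fun s hs =>
      runs_block (by simp [hs, encode])
    -- Unsatisfiable case: the NO instance needs parameter 1 even when d = 0, which is why the new
    -- parameter is bounded by d + 1.
    refine ⟨⟨⟨0, []⟩, 1⟩, runs_of_eq (.seq hsolve (.seq (.ite_false rfl (hstore _ rfl))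
      (runs_clearAll_workStacks false _ (5 * W ^ 2) ?_))) rfl ?_, ?_, by simp, by simp, by simp⟩
    · rintro (_ | _) <;> simp [Store.nil, length_encode, hb] <;> omega
    · omega
    · exact iff_of_false not_isYes_one fun h => by simpa using hfl.2 (hyes.1 h).1
  | true =>
    have hsat := hfl.1 rfl
    rw [and_iff_right hsat] at hyes
    obtain ⟨u, hu, hreduce⟩ := runs_reduce I.d (Pi.single 0 1) u₀ vs l hl true
    have hm := length_maskList_le u
    have htr : vs.length * (16 * (I.formula.numVars + 1) + 18) + 6 * (I.formula.numVars + 1) +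
        2 * I.d + 11 ≤ 60 * W ^ 3 := by
      rw [hlen]
      calc _ ≤ W * (16 * W + 18) + 6 * W + 2 * W + 11 := by gcongr
        _ = 16 * W ^ 2 + 26 * W + 11 := by ring
        _ ≤ _ := by omega
    have hi : (encVecs (vs.map (restrict u))).length ≤ 5 * W ^ 2 := by
      rw [length_encVecs, List.length_map, hlen]
      nlinarith
    by_cases hlt : (maskList u).length < 2 * I.d
    · rw [decide_eq_true hlt] at hreduce
      obtain ⟨ys, l', u', fl', hl', hfinish, hys, hspan⟩ := runs_finish I.d (vs.map (restrict u))
        (List.replicate ((maskList u).length - 2 * I.d) .var) true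
      have hlW' := hl'.length_le
      have hlen' : (eqnsOf ys).length = (maskList u).length := by simp [eqnsOf, hys]
      have htf : (maskList u).length * (4 * (maskList u).length + 8) + 1 +
          ((vs.map (restrict u)).length * ((maskList u).length * (8 * (maskList u).length + 9) +
          4 * (maskList u).length + 8) + 1 + ((maskList u).length * (2 * (maskList u).length + 5) +
          2 * (maskList u).length + 2 * I.d + 3)) ≤ 80 * W ^ 3 := by
        rw [List.length_map, hlen]
        have hm' : (maskList u).length ≤ W := hm.trans hn
        calc _ ≤ W * (4 * W + 8) + 1 + (W * (W * (8 * W + 9) + 4 * W + 8) + 1 +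
              (W * (2 * W + 5) + 2 * W + 2 * W + 3)) := by gcongr
          _ = 8 * W ^ 3 + 19 * W ^ 2 + 25 * W + 5 := by ring
          _ ≤ _ := by omega
      refine ⟨⟨⟨_, eqnsOf ys⟩, I.d⟩, runs_of_eq (.seq hsolve (.seq (.ite_true rfl
        (.seq hreduce (.ite_true rfl hfinish))) (runs_clearAll_workStacks fl' _
        (5 * W ^ 2) ?_))) rfl ?_, ?_, hlt.le, ?_, by simp⟩
      · have ho : (encode ⟨⟨_, eqnsOf ys⟩, I.d⟩).length ≤ 5 * W ^ 2 := by
          rw [length_encode]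
          simp only [hlen']
          nlinarith
        rintro (_ | _) <;> simp [Store.nil, ho] <;> omega
      · omega
      · rw [hyes]
        exact isYes_eqnsOf_iff u vs hu ys hspan
      · simpa [hlen'] using hlt.le
    · rw [decide_eq_false hlt] at hreduce
      -- At least 2d live coordinates: the empty word, already on the output stack, encodes a YES
      -- instance.
      refine ⟨⟨⟨0, []⟩, 0⟩, runs_of_eq (.seq hsolve (.seq (.ite_true rfl
        (.seq hreduce (.ite_false rfl (runs_block rfl)))) (runs_clearAll_workStacks false _
        (5 * W ^ 2) ?_))) rfl ?_, ?_, by simp, by simp, by simp⟩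
      · rintro (_ | _) <;> simp [Store.nil, hi] <;> omega
      · omega
      · exact iff_of_true isYes_zero (hyes.2 (exists_of_le_length_maskList u vs hu (by omega)))

end MaxDifferAffineSAT

/-- Max Differ Affine-SAT, parameterized by `d`, admits a polynomial kernel with `O(d ^ 2)`
variables and `O(d ^ 2)` equations. -/
theorem mainTheorem4 :
    ∃ f : MaxDifferAffineSAT → MaxDifferAffineSAT,
      MaxDifferAffineSAT.IsPolynomialKernelization f ∧
      ∃ C : ℕ, ∀ I : MaxDifferAffineSAT,
        (f I).formula.numVars ≤ C * I.d ^ 2 ∧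
        (f I).formula.equations.length ≤ C * I.d ^ 2 := by
  choose f hrun hyes hvars heqns hd using MaxDifferAffineSAT.exists_runs_main
  have hsq : ∀ d : ℕ, d ≤ d ^ 2 := fun d => Nat.le_self_pow two_ne_zero d
  -- The polynomial is the formula of `length_encode` at parameter d + 1 with 2d variables and 2d
  -- equations. Since d ≤ d², the linear bounds give the quadratic ones with C = 2.
  refine ⟨f, ⟨?_, hyes, (.X + 1) + (2 * .X + 2 * .X * (2 * .X + 2)), fun I => ?_⟩, 2, fun I =>
    ⟨(hvars I).trans (Nat.mul_le_mul_left 2 (hsq _)),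
      (heqns I).trans (Nat.mul_le_mul_left 2 (hsq _))⟩⟩
  · refine StackProg.computableInPolyTime MaxDifferAffineSAT.main .i .o
      (MaxDifferAffineSAT.reg 0 false) (500 * (.X + 2) ^ 3) fun I => ?_
    have hnil : (fun _ => []) = MaxDifferAffineSAT.Store.nil.fn := by
      funext k
      cases k <;> rfl
    rw [hnil, MaxDifferAffineSAT.Store.update_i, MaxDifferAffineSAT.Store.update_o]
    simpa using hrun I
  · rw [MaxDifferAffineSAT.length_encode]
    simp only [Polynomial.eval_add, Polynomial.eval_mul, Polynomial.eval_X, Polynomial.eval_one,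
      Polynomial.eval_ofNat]
    gcongr
    · exact hd I
    · exact hvars I
    · exact heqns I
    · exact hvars I
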